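/- **Theorem (burn-in).** Let $G\subseteq\mathbb{R}^d$ with its Borel $\sigma$-algebra $\mathcal{B}(G)$, let $K$ be a transition kernel on $(G,\mathcal{B}(G))$ that is reversible with respect to a probability measure $\pi$, and let $\nu$ be a probability measure on $(G,\mathcal{B}(G))$ that has a density $\frac{d\nu}{d\pi}\in L_2=L_2(\pi)$. Write $\|\cdot\|_2$ for the norm of $L_2(\pi)$, $Pf(x)=\int_G f(y)\,K(x,dy)$ for the Markov operator on $L_2$, $\nu P(A)=\int_G K(x,A)\,\nu(dx)$, $L_2^0=\{f\in L_2:\int_G f\,d\pi=0\}$, and $$\Lambda=\sup\{\lambda\in\mathrm{spec}(P\mid L_2^0)\},\qquad \Lambda_0=\max\{0,\Lambda\},\qquad \beta=\|P\|_{L_2^0\to L_2^0},$$ where $\Lambda:=0$ if $L_2^0=\{0\}$. Assume that $P$ is variance bounding, i.e. $\Lambda<1$. Let $\mathscr{A}\subseteq\mathcal{B}(G)$ be a set of test sets and for every $\delta>0$ let $\Gamma_\delta\subseteq\mathcal{B}(G)$ be a finite $\delta$-cover of $\mathscr{A}$ with respect to $\pi$: $\emptyset\in\Gamma_\delta$,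 and for every $A\in\mathscr{A}$ there are $C,D\in\Gamma_\delta$ with $C\subseteq A\subseteq D$ and $\pi(D\setminus C)\le\delta$. Let $\varphi\colon G\times[0,1]^s\to G$ be an update function of $K$, i.e. $\varphi$ is measurable and $K(x,A)=\lambda_s(\{u\in[0,1]^s:\varphi(x;u)\in A\})$ for all $x\in G$, $A\in\mathcal{B}(G)$, and let $\psi\colon[0,1]^s\to G$ be a generator function of $\nu$, i.e. $\psi$ is measurable and $\nu(A)=\lambda_s(\{u\in[0,1]^s:\psi(u)\in A\})$ for all $A\in\mathcal{B}(G)$; here $\lambda_k$ is Lebesgue measure on $\mathbb{R}^k$. For points $u_0,u_1,\dots\in[0,1]^s$ put $x_1=\psi(u_0)$ and $x_{i+1}=\varphi(x_i;u_i)$ for $i\ge1$, and for $i\ge 0$ let $C_{i,\psi}(A)\subseteq[0,1]^{(i+1)s}$ be the set of all $(u_0,\dots,u_i)$ for which $x_{i+1}\in A$. For $n_0\ge0$, $n\ge1$ and $\mathcal{U}_{n_0,n}=\{u_0,\dots,u_{n_0+n-1}\}$, $S_{[n_0,n]}=\{x_{n_0+1},\dots,x_{n_0+n}\}$ (finite sequences)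 define $$D^\ast_{\mathscr{A},\pi}(S_{[n_0,n]})=\sup_{A\in\mathscr{A}}\left|\frac1n\sum_{i=n_0+1}^{n_0+n}1_{x_i\in A}-\pi(A)\right|,$$ $$D^\ast_{n_0,\mathscr{A},\psi,\varphi}(\mathcal{U}_{n_0,n})=\sup_{A\in\mathscr{A}}\left|\frac1n\sum_{i=n_0}^{n_0+n-1}\left[1_{(u_0,\dots,u_i)\in C_{i,\psi}(A)}-\lambda_{(i+1)s}(C_{i,\psi}(A))\right]\right|.$$ Then, for all $n_0\ge0$, $n\ge1$ and $\delta>0$, the measure $\nu P^{n_0}$ has a density with respect to $\pi$ in $L_2$, and there exists a driver sequence $\mathcal{U}_{n_0,n}=\{u_0,\dots,u_{n_0+n-1}\}\subset[0,1]^s$ such that $$D^\ast_{\mathscr{A},\pi}(S_{[n_0,n]})\le\sqrt{\frac{1+\Lambda_0}{1-\Lambda_0}}\cdot\frac{\sqrt{2\log\left(|\Gamma_\delta|^2\left\|\frac{d(\nu P^{n_0})}{d\pi}\right\|_2\right)}}{\sqrt n}+\delta .$$ If moreover $P$ has an absolute $L_2$-spectral gap, i.e. $\beta<1$, then $\Lambda\le\Lambda_0\le\beta$,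 $|\Lambda|\le\beta$, and the same driver sequence satisfies $$D^\ast_{n_0,\mathscr{A},\psi,\varphi}(\mathcal{U}_{n_0,n})\le\sqrt{\frac{1+\Lambda_0}{1-\Lambda_0}}\cdot\frac{\sqrt{2\log\left(|\Gamma_\delta|^2\left(1+\beta^{n_0}\left\|\frac{d\nu}{d\pi}-1\right\|_2\right)\right)}}{\sqrt n}+\frac{(1-\Lambda_0^n)\,\beta^{n_0}}{n(1-\Lambda_0)}\left\|\frac{d\nu}{d\pi}-1\right\|_2+\delta$$ and in particular $$D^\ast_{n_0,\mathscr{A},\psi,\varphi}(\mathcal{U}_{n_0,n})\le\frac{4\sqrt{\log\left(|\Gamma_\delta|^2\left(1+\beta^{n_0}\left\|\frac{d\nu}{d\pi}-1\right\|_2\right)\right)}}{\sqrt{n(1-\beta)}}+\frac{2\beta^{n_0}\left\|\frac{d\nu}{d\pi}-1\right\|_2}{n(1-\beta)}+\delta .$$ -/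

import Mathlib

open MeasureTheory ProbabilityTheory
open scoped ENNReal

noncomputable section

namespace MCQMC

section MarkovOperator

variable {X : Type*} [MeasurableSpace X]

lemma ae_integrable_kernel {K : Kernel X X} [IsMarkovKernel K] {π : Measure X}
    [IsProbabilityMeasure π] (hK : K.Invariant π) (f : Lp ℝ 2 π) :
    ∀ᵐ x ∂π, Integrable f (K x) := by
  have hf : Integrable f (π.bind K) := by
    rw [hK.def]; exact (Lp.memLp f).integrable (by norm_num)
  exact ((Measure.integrable_comp_iff hf.1).1 hf).1

lemma memLp_integral_kernel {K : Kernel X X} [IsMarkovKernel K] {π : Measure X}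
    [IsProbabilityMeasure π] (hK : K.Invariant π) (f : Lp ℝ 2 π) :
    MemLp (fun x => ∫ y, f y ∂K x) 2 π ∧
      eLpNorm (fun x => ∫ y, f y ∂K x) 2 π ≤ eLpNorm f 2 π := by
  have hfm : StronglyMeasurable (f : X → ℝ) := Lp.stronglyMeasurable f
  have hle : eLpNorm (fun x => ∫ y, f y ∂K x) 2 π ≤ eLpNorm f 2 π := by
    have h1 : ∀ x, ‖∫ y, f y ∂K x‖ₑ ^ (2 : ℝ) ≤ ∫⁻ y, ‖f y‖ₑ ^ (2 : ℝ) ∂K x := by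
      intro x
      have h2 : ‖∫ y, f y ∂K x‖ₑ ≤ eLpNorm f 2 (K x) := by
        refine (enorm_integral_le_lintegral_enorm _).trans ?_
        rw [← eLpNorm_one_eq_lintegral_enorm]
        exact eLpNorm_le_eLpNorm_of_exponent_le (by norm_num) hfm.aestronglyMeasurable
      calc ‖∫ y, f y ∂K x‖ₑ ^ (2 : ℝ) ≤ (eLpNorm f 2 (K x)) ^ (2 : ℝ) := by gcongr
        _ = ∫⁻ y, ‖f y‖ₑ ^ (2 : ℝ) ∂K x := by
          rw [eLpNorm_eq_lintegral_rpow_enorm_toReal (by norm_num) (by norm_num)]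
          rw [← ENNReal.rpow_mul]
          norm_num
    rw [eLpNorm_eq_lintegral_rpow_enorm_toReal (by norm_num) (by norm_num),
      eLpNorm_eq_lintegral_rpow_enorm_toReal (by norm_num) (by norm_num)]
    simp only [ENNReal.toReal_ofNat]
    refine ENNReal.rpow_le_rpow ?_ (by norm_num)
    calc ∫⁻ x, ‖∫ y, f y ∂K x‖ₑ ^ (2 : ℝ) ∂π
        ≤ ∫⁻ x, ∫⁻ y, ‖f y‖ₑ ^ (2 : ℝ) ∂K x ∂π := lintegral_mono h1
      _ = ∫⁻ y, ‖f y‖ₑ ^ (2 : ℝ) ∂(π.bind K) :=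
          (Measure.lintegral_bind (Kernel.aemeasurable _)
            (hfm.measurable.enorm.pow_const _).aemeasurable).symm
      _ = ∫⁻ y, ‖f y‖ₑ ^ (2 : ℝ) ∂π := by rw [hK.def]
  exact ⟨⟨(hfm.integral_kernel).aestronglyMeasurable, hle.trans_lt (Lp.eLpNorm_lt_top f)⟩, hle⟩

/-- The Markov operator `P : L₂(π) → L₂(π)`, `(P f)(x) = ∫ f(y) K(x, dy)`, of a transition
kernel `K` with stationary distribution `π`. -/
def markovOp (K : Kernel X X) [IsMarkovKernel K] (π : Measure X) [IsProbabilityMeasure π]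
    (hK : K.Invariant π) : Lp ℝ 2 π →L[ℝ] Lp ℝ 2 π :=
  LinearMap.mkContinuous
    { toFun := fun f => (memLp_integral_kernel hK f).1.toLp (fun x => ∫ y, f y ∂K x)
      map_add' := by
        intro f g
        rw [← MemLp.toLp_add, MemLp.toLp_eq_toLp_iff]
        have hfg : ∀ᵐ y ∂(π.bind K), (f + g : Lp ℝ 2 π) y = f y + g y := by
          rw [hK.def]; exact Lp.coeFn_add f g
        filter_upwards [Measure.ae_ae_of_ae_comp hfg, ae_integrable_kernel hK f,
          ae_integrable_kernel hK g] with x hx hf hg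
        rw [integral_congr_ae hx, Pi.add_apply, integral_add hf hg]
      map_smul' := by
        intro c f
        rw [RingHom.id_apply, ← MemLp.toLp_const_smul, MemLp.toLp_eq_toLp_iff]
        have hcf : ∀ᵐ y ∂(π.bind K), (c • f : Lp ℝ 2 π) y = c • f y := by
          rw [hK.def]; exact Lp.coeFn_smul c f
        filter_upwards [Measure.ae_ae_of_ae_comp hcf] with x hx
        rw [integral_congr_ae hx, Pi.smul_apply, integral_smul] }
    1 (by
      intro f
      rw [one_mul, Lp.norm_def f]
      simp only [LinearMap.coe_mk, AddHom.coe_mk]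
      rw [Lp.norm_toLp]
      exact ENNReal.toReal_mono (Lp.eLpNorm_ne_top f) (memLp_integral_kernel hK f).2)

lemma markovOp_coeFn (K : Kernel X X) [IsMarkovKernel K] (π : Measure X)
    [IsProbabilityMeasure π] (hK : K.Invariant π) (f : Lp ℝ 2 π) :
    markovOp K π hK f =ᵐ[π] fun x => ∫ y, f y ∂K x :=
  MemLp.coeFn_toLp (memLp_integral_kernel hK f).1

/-- The subspace `L₂⁰(π)` of all `f ∈ L₂(π)` with `∫ f dπ = 0`. -/
def L20 (π : Measure X) [IsProbabilityMeasure π] : Submodule ℝ (Lp ℝ 2 π) where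
  carrier := {f | ∫ x, f x ∂π = 0}
  zero_mem' := by
    change ∫ x, (0 : Lp ℝ 2 π) x ∂π = 0
    rw [integral_congr_ae (Lp.coeFn_zero ℝ 2 π)]
    simp
  add_mem' := by
    intro f g hf hg
    change ∫ x, (f + g : Lp ℝ 2 π) x ∂π = 0
    rw [integral_congr_ae (Lp.coeFn_add f g)]
    simp only [Pi.add_apply]
    rw [integral_add ((Lp.memLp f).integrable (by norm_num))
      ((Lp.memLp g).integrable (by norm_num)), hf, hg, add_zero]
  smul_mem' := by
    intro c f hf
    change ∫ x, (c • f : Lp ℝ 2 π) x ∂π = 0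
    rw [integral_congr_ae (Lp.coeFn_smul c f)]
    simp only [Pi.smul_apply]
    rw [integral_smul, hf, smul_zero]

lemma markovOp_mem_L20 (K : Kernel X X) [IsMarkovKernel K] (π : Measure X)
    [IsProbabilityMeasure π] (hK : K.Invariant π) (f : Lp ℝ 2 π) (hf : f ∈ L20 π) :
    markovOp K π hK f ∈ L20 π := by
  change ∫ x, markovOp K π hK f x ∂π = 0
  have hint : Integrable f (π.bind K) := by
    rw [hK.def]; exact (Lp.memLp f).integrable (by norm_num)
  have hcomp : ∫ y, f y ∂(π.bind K) = ∫ x, ∫ y, f y ∂K x ∂π := by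
    rw [Measure.comp_eq_comp_const_apply] at hint ⊢
    rw [Kernel.integral_comp hint, Kernel.const_apply]
  rw [integral_congr_ae (markovOp_coeFn K π hK f), ← hcomp, hK.def]
  exact hf

/-- The restriction `P : L₂⁰(π) → L₂⁰(π)` of the Markov operator. -/
def markovOp0 (K : Kernel X X) [IsMarkovKernel K] (π : Measure X) [IsProbabilityMeasure π]
    (hK : K.Invariant π) : L20 π →L[ℝ] L20 π :=
  (markovOp K π hK).restrict (markovOp_mem_L20 K π hK)

/-- `Λ = sup {λ : λ ∈ spec(P | L₂⁰)}`. (If `L₂⁰ = {0}`, the spectrum is empty and the supremum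
is `0` by convention; only `max 0 Λ`, `|Λ|` and `Λ < 1` are used.) -/
def specSup (K : Kernel X X) [IsMarkovKernel K] (π : Measure X) [IsProbabilityMeasure π]
    (hK : K.Invariant π) : ℝ :=
  sSup (spectrum ℝ (markovOp0 K π hK))

/-- `K` (or its Markov operator) is variance bounding: `Λ < 1`. -/
def VarianceBounding (K : Kernel X X) [IsMarkovKernel K] (π : Measure X)
    [IsProbabilityMeasure π] (hK : K.Invariant π) : Prop :=
  specSup K π hK < 1

/-- `β = ‖P‖_{L₂⁰ → L₂⁰}`, the operator norm. -/
def opNorm0 (K : Kernel X X) [IsMarkovKernel K] (π : Measure X) [IsProbabilityMeasure π]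
    (hK : K.Invariant π) : ℝ :=
  ‖markovOp0 K π hK‖

/-- `K` (or its Markov operator) has an absolute `L₂`-spectral gap: `β < 1`. -/
def HasAbsSpectralGap (K : Kernel X X) [IsMarkovKernel K] (π : Measure X)
    [IsProbabilityMeasure π] (hK : K.Invariant π) : Prop :=
  opNorm0 K π hK < 1

/-- The measure `ν Pᵐ`, where `(μ P)(A) = ∫ K(x, A) μ(dx)`. -/
def iterMeasure (K : Kernel X X) (ν : Measure X) (m : ℕ) : Measure X :=
  (fun μ : Measure X => μ.bind K)^[m] ν

/-- The density `dν/dπ` exists and belongs to `L₂(π)`. -/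
def HasL2Density (ν π : Measure X) : Prop :=
  ν ≪ π ∧ MemLp (fun x => (ν.rnDeriv π x).toReal) 2 π

/-- `‖dν/dπ‖₂`. -/
def densityNorm (ν π : Measure X) : ℝ :=
  (eLpNorm (fun x => (ν.rnDeriv π x).toReal) 2 π).toReal

/-- `‖dν/dπ - 1‖₂`. -/
def densitySubOneNorm (ν π : Measure X) : ℝ :=
  (eLpNorm (fun x => (ν.rnDeriv π x).toReal - 1) 2 π).toReal

end MarkovOperator

section Driver

/-- The unit cube `[0,1]^s`, with Lebesgue measure `volume`. -/
abbrev Cube (s : ℕ) : Type := Fin s → unitInterval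

variable {X : Type*} [MeasurableSpace X] {s : ℕ}

/-- `φ` is an update function of `K`. -/
def IsUpdateFunction (φ : X → Cube s → X) (K : Kernel X X) : Prop :=
  Measurable (fun p : X × Cube s => φ p.1 p.2) ∧
    ∀ (x : X) (A : Set X), MeasurableSet A → K x A = volume {u : Cube s | φ x u ∈ A}

/-- `ψ` is a generator function of `ν`. -/
def IsGeneratorFunction (ψ : Cube s → X) (ν : Measure X) : Prop :=
  Measurable ψ ∧ ∀ A : Set X, MeasurableSet A → ν A = volume {u : Cube s | ψ u ∈ A}

/-- `chainState φ ψ i (u₀, …, uᵢ) = φᵢ(ψ(u₀); u₁, …, uᵢ) = x_{i+1}`, that is, `x₁ = ψ(u₀)` and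
`x_{i+1} = φ(xᵢ; uᵢ)`. -/
def chainState (φ : X → Cube s → X) (ψ : Cube s → X) : (i : ℕ) → (Fin (i + 1) → Cube s) → X
  | 0, u => ψ (u 0)
  | i + 1, u => φ (chainState φ ψ i (Fin.init u)) (u (Fin.last (i + 1)))

/-- The set `C_{i,ψ}(A) ⊆ [0,1]^{(i+1)s}`. -/
def pullBack (φ : X → Cube s → X) (ψ : Cube s → X) (i : ℕ) (A : Set X) :
    Set (Fin (i + 1) → Cube s) :=
  {u | chainState φ ψ i u ∈ A}

/-- The initial segment `(u₀, …, uᵢ)` of a finite sequence `u₀, …, u_{N-1}`. -/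
def initialSegment {N : ℕ} (u : Fin N → Cube s) (i : Fin N) : Fin (i.val + 1) → Cube s :=
  fun k => u (Fin.castLE i.isLt k)

/-- The points `x_{n₀+1}, …, x_{n₀+n}` generated by the driver sequence
`u₀, …, u_{n₀+n-1}`. -/
def burnInPoints (φ : X → Cube s → X) (ψ : Cube s → X) (n₀ n : ℕ)
    (u : Fin (n₀ + n) → Cube s) (j : Fin n) : X :=
  chainState φ ψ (n₀ + j.val) (initialSegment u (Fin.natAdd n₀ j))

/-- The star-discrepancy of the points `z₁, …, zₙ` with respect to the probability measure `π`
and the class `𝒜` of test sets. -/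
def starDiscrepancy (𝒜 : Set (Set X)) (π : Measure X) {n : ℕ} (z : Fin n → X) : ℝ :=
  ⨆ A : 𝒜, |(1 / (n : ℝ)) * ∑ j : Fin n, (A : Set X).indicator (fun _ => (1 : ℝ)) (z j) -
    π.real (A : Set X)|

/-- The local discrepancy function with burn-in of a driver sequence `u₀, …, u_{n₀+n-1}`. The
summation index is `i = n₀ + j`, `0 ≤ j < n`. -/
def localDiscrepancyBurnIn (φ : X → Cube s → X) (ψ : Cube s → X) (n₀ n : ℕ) (A : Set X)
    (u : Fin (n₀ + n) → Cube s) : ℝ :=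
  (1 / (n : ℝ)) * ∑ j : Fin n,
    ((pullBack φ ψ (n₀ + j.val) A).indicator (fun _ => (1 : ℝ))
        (initialSegment u (Fin.natAdd n₀ j)) -
      volume.real (pullBack φ ψ (n₀ + j.val) A))

/-- The pull-back discrepancy with burn-in. -/
def pullBackDiscrepancyBurnIn (𝒜 : Set (Set X)) (φ : X → Cube s → X) (ψ : Cube s → X)
    (n₀ n : ℕ) (u : Fin (n₀ + n) → Cube s) : ℝ :=
  ⨆ A : 𝒜, |localDiscrepancyBurnIn φ ψ n₀ n (A : Set X) u|

/-- The finite family `Γ` of measurable sets is a `δ`-cover of `𝒜` with respect to `π`. -/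
structure IsDeltaCover (π : Measure X) (𝒜 : Set (Set X)) (δ : ℝ) (Γ : Finset (Set X)) :
    Prop where
  measurableSet : ∀ C ∈ Γ, MeasurableSet C
  empty_mem : ∅ ∈ Γ
  bracket : ∀ A ∈ 𝒜, ∃ C ∈ Γ, ∃ D ∈ Γ, C ⊆ A ∧ A ⊆ D ∧ π.real (D \ C) ≤ δ

end Driver

end MCQMC

end

/-! The driver sequence is found by the probabilistic method. For uniform random `u` the points form
the Markov chain with initial law `ν` and kernel `K`. If each set of the finite cover has a small
probability of a large deviation, a union bound leaves some `u` that is good for all of them at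
once, and bracketing extends this to `𝒜` at the cost `δ` (`exists_driver`,
`IsDeltaCover.abs_sub_le`).

The deviation estimate `volume_deviation_le` is a Hoeffding inequality obtained from spectral
theory. With `E = exp(t 1_A / 2)`, the stationary moment generating function of `n` visits to `A` is
`⟨E, (E P E)^(n-1) E⟩`, so the norm of the symmetric operator `E P E` has to be bounded. With `l =
Λ₀` and `Π` the projection on the constants, `P ≤ l + (1 - l) Π` (`inner_markovOp_le`).
Cauchy-Schwarz on `A` and on its complement then reduces the quadratic form to a 2 × 2 matrix, that
of the two-state chain, whose top eigenvalue is at most `exp(t p + t² R / 8)` with `p = π(A)` and `R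
= (1 + l)/(1 - l)` (`two_state_quadratic_le`). Positivity of `P` on functions bounds the absolute
value of the form as well, so the negative part of the spectrum does no harm. The initial law enters
by Cauchy-Schwarz against its density, which doubles `t` and yields the factor `‖d(νP^n₀)/dπ‖₂`.

For the pull-back discrepancy, `λ(C_i(A)) = νP^i(A)` has to be compared with `π(A)`. The averaged
bias is a pairing of `1_A` with `∑ P^j` applied to `P^n₀ (dν/dπ - 1)`. The geometric sum has norm at
most `∑ Λ₀^j` on `L₂⁰` (`norm_geom_sum_apply_le`), and each burn-in step contributes a factor `β`.
-/

noncomputable section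

namespace MCQMC

/-! ### Symmetric operators: Rayleigh quotients, spectrum and geometric sums. -/

section Hilbert

open scoped InnerProductSpace

variable {E : Type*} [NormedAddCommGroup E] [InnerProductSpace ℝ E]

/-- Cauchy-Schwarz for the semi-inner product of a positive operator. -/
lemma IsPositive.inner_sq_le {A : E →L[ℝ] E} (hA : A.IsPositive) (x y : E) :
    ⟪A x, y⟫_ℝ ^ 2 ≤ ⟪A x, x⟫_ℝ * ⟪A y, y⟫_ℝ := by
  have h : ∀ s : ℝ, 0 ≤ ⟪A y, y⟫_ℝ * (s * s) + (2 * ⟪A x, y⟫_ℝ) * s + ⟪A x, x⟫_ℝ := by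
    intro s
    have h1 := hA.inner_nonneg_left (x + s • y)
    have h2 : ⟪A y, x⟫_ℝ = ⟪A x, y⟫_ℝ := by
      rw [hA.inner_left_eq_inner_right, real_inner_comm]
    simp only [map_add, map_smul, inner_add_left, inner_add_right, inner_smul_left,
      inner_smul_right, h2, RCLike.conj_to_real] at h1
    linarith
  have := discrim_le_zero h
  rw [discrim] at this
  linarith

/-- Cauchy-Schwarz for the form of `A`, applied to `x` and `A x`, gives `‖A x‖⁴ ≤ ⟪A x, x⟫ · c ‖A
x‖²`. This turns bounds on the form into bounds on the norm without a square root of `A`. -/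
lemma IsPositive.norm_sq_le_of_le {A : E →L[ℝ] E} (hA : A.IsPositive) {c : ℝ}
    (hc : ∀ x, ⟪A x, x⟫_ℝ ≤ c * ‖x‖ ^ 2) (x : E) :
    ‖A x‖ ^ 2 ≤ c * ⟪A x, x⟫_ℝ := by
  have h1 := IsPositive.inner_sq_le hA x (A x)
  rw [real_inner_self_eq_norm_sq] at h1
  have h2 := mul_le_mul_of_nonneg_left (hc (A x)) (hA.inner_nonneg_left x)
  rcases eq_or_lt_of_le (sq_nonneg ‖A x‖) with h | h
  · rw [← h]
    have h3 : ‖A x‖ = 0 := by nlinarith [norm_nonneg (A x)]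
    rw [norm_eq_zero.1 h3]; simp
  · nlinarith

lemma IsPositive.norm_apply_le_of_le {A : E →L[ℝ] E} (hA : A.IsPositive) {c : ℝ}
    (hc0 : 0 ≤ c) (hc : ∀ x, ⟪A x, x⟫_ℝ ≤ c * ‖x‖ ^ 2) (x : E) : ‖A x‖ ≤ c * ‖x‖ := by
  refine abs_le_of_sq_le_sq' ?_ (by positivity) |>.2
  calc ‖A x‖ ^ 2 ≤ c * ⟪A x, x⟫_ℝ := IsPositive.norm_sq_le_of_le hA hc x
    _ ≤ c * (c * ‖x‖ ^ 2) := by gcongr; exact hc x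
    _ = _ := by ring

/-- The supremum of the Rayleigh quotients of a symmetric operator lies in its spectrum. -/
lemma exists_mem_spectrum_inner_le [Nontrivial E] {T : E →L[ℝ] E}
    (hT : (T : E →ₗ[ℝ] E).IsSymmetric) :
    ∃ M ∈ spectrum ℝ T, ∀ x, ⟪T x, x⟫_ℝ ≤ M * ‖x‖ ^ 2 := by
  let S : Set ℝ := {r | ∃ x : E, ‖x‖ = 1 ∧ ⟪T x, x⟫_ℝ = r}
  have hSb : BddAbove S := by
    refine ⟨‖T‖, ?_⟩
    rintro r ⟨x, hx, rfl⟩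
    calc ⟪T x, x⟫_ℝ ≤ ‖T x‖ * ‖x‖ := real_inner_le_norm _ _
      _ ≤ ‖T‖ := by rw [hx, mul_one]; simpa [hx] using T.le_opNorm x
  have hSn : S.Nonempty := by
    obtain ⟨x, hx⟩ := exists_norm_eq E (zero_le_one (α := ℝ))
    exact ⟨_, x, hx, rfl⟩
  have hle : ∀ x, ⟪T x, x⟫_ℝ ≤ sSup S * ‖x‖ ^ 2 := by
    intro x
    by_cases hx : x = 0
    · simp [hx]
    have hx' : 0 < ‖x‖ := norm_pos_iff.2 hx
    have h1 : ⟪T (‖x‖⁻¹ • x), ‖x‖⁻¹ • x⟫_ℝ ≤ sSup S :=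
      le_csSup hSb ⟨_, by rw [norm_smul, norm_inv, norm_norm, inv_mul_cancel₀ hx'.ne'], rfl⟩
    simp only [map_smul, inner_smul_left, inner_smul_right, RCLike.conj_to_real] at h1
    have h2 : ‖x‖ * ‖x‖⁻¹ = 1 := mul_inv_cancel₀ hx'.ne'
    calc ⟪T x, x⟫_ℝ = (‖x‖ * ‖x‖⁻¹) ^ 2 * ⟪T x, x⟫_ℝ := by rw [h2]; ring
      _ = ‖x‖ ^ 2 * (‖x‖⁻¹ * (‖x‖⁻¹ * ⟪T x, x⟫_ℝ)) := by ring
      _ ≤ ‖x‖ ^ 2 * sSup S := by gcongr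
      _ = _ := mul_comm _ _
  -- If `U = sSup S - T` were invertible with inverse `V`, positivity of `U` would give `1 = ‖V U
  -- x‖² ≤ c ⟪U x, x⟫` on unit vectors. But `⟪U x, x⟫` is arbitrarily small along a maximizing
  -- sequence.
  refine ⟨sSup S, ?_, hle⟩
  rw [spectrum.mem_iff]
  rintro ⟨U, hU⟩
  have hUx : ∀ x, (U : E →L[ℝ] E) x = sSup S • x - T x := by
    intro x; rw [hU]; simp [Algebra.algebraMap_eq_smul_one]
  have hpos : (U : E →L[ℝ] E).IsPositive := by
    refine ⟨?_, ?_⟩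
    · intro x y
      have := hT x y
      simp only [ContinuousLinearMap.coe_coe] at this ⊢
      rw [hUx, hUx, inner_sub_left, inner_sub_right, this, inner_smul_left, inner_smul_right]
      simp
    · intro x
      have := hle x
      simp only [ContinuousLinearMap.reApplyInnerSelf_apply, RCLike.re_to_real]
      rw [hUx, inner_sub_left, inner_smul_left, real_inner_self_eq_norm_sq]
      simpa using this
  set V : E →L[ℝ] E := ((U⁻¹ : (E →L[ℝ] E)ˣ) : E →L[ℝ] E)
  have hVU : ∀ x, V ((U : E →L[ℝ] E) x) = x := by
    intro x
    have : (V * (U : E →L[ℝ] E)) x = x := by rw [Units.inv_mul]; rfl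
    exact this
  have hUle : ∀ x, ⟪(U : E →L[ℝ] E) x, x⟫_ℝ ≤ ‖(U : E →L[ℝ] E)‖ * ‖x‖ ^ 2 := by
    intro x
    calc _ ≤ ‖(U : E →L[ℝ] E) x‖ * ‖x‖ := real_inner_le_norm _ _
      _ ≤ (‖(U : E →L[ℝ] E)‖ * ‖x‖) * ‖x‖ := by gcongr; exact (U : E →L[ℝ] E).le_opNorm x
      _ = _ := by ring
  set c : ℝ := ‖V‖ ^ 2 * ‖(U : E →L[ℝ] E)‖
  have hc0 : 0 ≤ c := by positivity
  obtain ⟨r, ⟨x, hx, rfl⟩, hr⟩ := exists_lt_of_lt_csSup hSn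
    (show sSup S - 1 / (c + 1) < sSup S by linarith [show 0 < 1 / (c + 1) by positivity])
  have h1 : ⟪(U : E →L[ℝ] E) x, x⟫_ℝ < 1 / (c + 1) := by
    rw [hUx, inner_sub_left, inner_smul_left, real_inner_self_eq_norm_sq, hx]
    simp only [RCLike.conj_to_real]
    linarith
  have h2 : (1 : ℝ) ≤ c * ⟪(U : E →L[ℝ] E) x, x⟫_ℝ := by
    calc (1 : ℝ) = ‖V ((U : E →L[ℝ] E) x)‖ ^ 2 := by rw [hVU, hx]; norm_num
      _ ≤ (‖V‖ * ‖(U : E →L[ℝ] E) x‖) ^ 2 := by gcongr; exact V.le_opNorm _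
      _ = ‖V‖ ^ 2 * ‖(U : E →L[ℝ] E) x‖ ^ 2 := by ring
      _ ≤ ‖V‖ ^ 2 * (‖(U : E →L[ℝ] E)‖ * ⟪(U : E →L[ℝ] E) x, x⟫_ℝ) := by
        gcongr; exact IsPositive.norm_sq_le_of_le hpos hUle x
      _ = _ := by ring
  have h3 : c * ⟪(U : E →L[ℝ] E) x, x⟫_ℝ ≤ c * (1 / (c + 1)) := by gcongr
  have h4 : c * (1 / (c + 1)) < 1 := by
    rw [mul_one_div, div_lt_one (by positivity)]; linarith
  linarith

lemma spectrum_subset_Icc [CompleteSpace E] [Nontrivial E] (T : E →L[ℝ] E) :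
    spectrum ℝ T ⊆ Set.Icc (-‖T‖) ‖T‖ := by
  intro r hr
  have := spectrum.norm_le_norm_of_mem hr
  rwa [Real.norm_eq_abs, abs_le] at this

/-- A symmetric operator is bounded above by the supremum of its spectrum. -/
lemma inner_le_sSup_spectrum [CompleteSpace E] {T : E →L[ℝ] E}
    (hT : (T : E →ₗ[ℝ] E).IsSymmetric) (x : E) :
    ⟪T x, x⟫_ℝ ≤ sSup (spectrum ℝ T) * ‖x‖ ^ 2 := by
  rcases subsingleton_or_nontrivial E with h | h
  · rw [Subsingleton.elim x 0]; simp
  obtain ⟨M, hM, hle⟩ := exists_mem_spectrum_inner_le hT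
  refine (hle x).trans ?_
  gcongr
  exact le_csSup ⟨_, fun r hr => (spectrum_subset_Icc T hr).2⟩ hM

/-- The spectrum lies in `[-‖T‖, ‖T‖]`. The lower bound on the supremum also needs a spectral point,
which the Rayleigh quotients supply; on the trivial space the supremum of the empty set is `0`. -/
lemma abs_sSup_spectrum_le [CompleteSpace E] {T : E →L[ℝ] E}
    (hT : (T : E →ₗ[ℝ] E).IsSymmetric) :
    |sSup (spectrum ℝ T)| ≤ ‖T‖ := by
  rcases subsingleton_or_nontrivial E with h | h
  · rw [spectrum.of_subsingleton]; simp
  obtain ⟨M, hM, -⟩ := exists_mem_spectrum_inner_le hT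
  rw [abs_le]
  exact ⟨(spectrum_subset_Icc T hM).1.trans
      (le_csSup ⟨_, fun r hr => (spectrum_subset_Icc T hr).2⟩ hM),
    csSup_le ⟨M, hM⟩ fun r hr => (spectrum_subset_Icc T hr).2⟩

lemma isPositive_of_isSelfAdjoint [CompleteSpace E] {A : E →L[ℝ] E} (hA : IsSelfAdjoint A)
    (h : ∀ x, 0 ≤ ⟪A x, x⟫_ℝ) : A.IsPositive :=
  ⟨hA.isSymmetric, fun x => by
    simpa only [ContinuousLinearMap.reApplyInnerSelf_apply, RCLike.re_to_real] using h x⟩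

lemma IsPositive.conj_isSelfAdjoint [CompleteSpace E] {A B : E →L[ℝ] E} (hA : A.IsPositive)
    (hB : IsSelfAdjoint B) : (B * A * B).IsPositive := by
  have := hA.conj_adjoint B
  rwa [hB.adjoint_eq] at this

/-- If `-1 ≤ T ≤ l` with `0 ≤ l`, then `∑_{j<n} T^j` and `(l - T) ∑_{j<n} T^j` are positive. -/
lemma isPositive_geom_sum [CompleteSpace E] {T : E →L[ℝ] E} {l : ℝ} (hl : 0 ≤ l)
    (hA : (l • (1 : E →L[ℝ] E) - T).IsPositive) (hB : (1 + T).IsPositive)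
    (hT : IsSelfAdjoint T) (n : ℕ) :
    (∑ j ∈ Finset.range n, T ^ j).IsPositive ∧
      ((l • (1 : E →L[ℝ] E) - T) * ∑ j ∈ Finset.range n, T ^ j).IsPositive := by
  -- With the commuting operators `A = l - T` and `B = 1 + T`, `A + B = 1 + l` gives `(1 + l) A B =
  -- B A B + A B A`, a sum of positive operators.
  have hAB : ((l • (1 : E →L[ℝ] E) - T) * (1 + T)).IsPositive := by
    have h1 := (IsPositive.conj_isSelfAdjoint hB hA.isSelfAdjoint).add
      (IsPositive.conj_isSelfAdjoint hA hB.isSelfAdjoint)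
    have h2 := h1.smul_of_nonneg (c := (1 + l)⁻¹) (by positivity)
    convert h2 using 1
    have h3 : (1 + l) ≠ 0 := by positivity
    rw [eq_inv_smul_iff₀ h3]
    simp only [add_smul, one_smul, mul_add, add_mul, sub_mul, mul_sub, smul_mul_assoc,
      mul_smul_comm, one_mul, mul_one, smul_sub, smul_add, mul_assoc]
    abel
  -- Peeling off two powers at a time leaves the conjugation `T S T` of a shorter sum, which
  -- preserves positivity even where `T` is negative. Hence the two-step induction.
  have hs : ∀ n, ∑ j ∈ Finset.range (n + 2), T ^ j =
      (1 + T) + T * (∑ j ∈ Finset.range n, T ^ j) * T := by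
    intro n
    rw [Finset.sum_range_succ', Finset.sum_range_succ', Finset.mul_sum, Finset.sum_mul]
    simp only [pow_zero, zero_add, pow_one]
    have h : ∀ j, T ^ (j + 1 + 1) = T * T ^ j * T := fun j => by rw [← pow_succ', ← pow_succ]
    simp only [h]
    abel
  induction n using Nat.twoStepInduction with
  | zero => simp [ContinuousLinearMap.isPositive_zero]
  | one =>
    rw [Finset.sum_range_one, pow_zero, mul_one]
    exact ⟨ContinuousLinearMap.isPositive_one, hA⟩
  | more n ih _ =>
    rw [hs]
    refine ⟨hB.add (IsPositive.conj_isSelfAdjoint ih.1 hT), ?_⟩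
    rw [mul_add]
    refine hAB.add ?_
    convert IsPositive.conj_isSelfAdjoint ih.2 hT using 1
    simp only [← mul_assoc]
    congr 2
    simp only [sub_mul, mul_sub, smul_mul_assoc, mul_smul_comm, one_mul, mul_one]

/-- If `T` is self-adjoint with `-1 ≤ T ≤ l`, `0 ≤ l`, then `‖∑_{j<n} T^j‖ ≤ ∑_{j<n} l^j`. -/
lemma norm_geom_sum_apply_le [CompleteSpace E] {T : E →L[ℝ] E} {l : ℝ} (hl : 0 ≤ l)
    (hT : IsSelfAdjoint T) (h1 : ∀ x, -‖x‖ ^ 2 ≤ ⟪T x, x⟫_ℝ)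
    (h2 : ∀ x, ⟪T x, x⟫_ℝ ≤ l * ‖x‖ ^ 2) (n : ℕ) (x : E) :
    ‖(∑ j ∈ Finset.range n, T ^ j) x‖ ≤ (∑ j ∈ Finset.range n, l ^ j) * ‖x‖ := by
  have hA : (l • (1 : E →L[ℝ] E) - T).IsPositive := by
    refine isPositive_of_isSelfAdjoint (((IsSelfAdjoint.all l).smul (IsSelfAdjoint.one _)).sub hT)
      fun x => ?_
    have := h2 x
    simp only [sub_apply, smul_apply,
      one_apply_eq_self, inner_sub_left, inner_smul_left, RCLike.conj_to_real,
      real_inner_self_eq_norm_sq]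
    linarith
  have hB : (1 + T).IsPositive := by
    refine isPositive_of_isSelfAdjoint ((IsSelfAdjoint.one _).add hT) fun x => ?_
    have := h1 x
    simp only [add_apply,
      one_apply_eq_self, inner_add_left, real_inner_self_eq_norm_sq]
    linarith
  -- The recursion is `D (n + 1) = l D n + (l - T) S n`, where `S n` is the geometric sum and `D n`
  -- its defect from `∑ l ^ j`.
  have hD : ∀ n, ((∑ j ∈ Finset.range n, l ^ j) • (1 : E →L[ℝ] E) -
      ∑ j ∈ Finset.range n, T ^ j).IsPositive := by
    intro n
    induction n with
    | zero => simp [ContinuousLinearMap.isPositive_zero]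
    | succ n ih =>
      have h3 := (ih.smul_of_nonneg hl).add (isPositive_geom_sum hl hA hB hT n).2
      convert h3 using 1
      rw [geom_sum_succ, geom_sum_succ]
      simp only [sub_mul, smul_sub, add_smul, smul_smul, one_smul, smul_mul_assoc, one_mul]
      abel
  refine IsPositive.norm_apply_le_of_le (isPositive_geom_sum hl hA hB hT n).1
    (Finset.sum_nonneg fun j _ => by positivity) (fun x => ?_) x
  have := (hD n).inner_nonneg_left x
  simp only [sub_apply, smul_apply,
      one_apply_eq_self, inner_sub_left, inner_smul_left, RCLike.conj_to_real,
      real_inner_self_eq_norm_sq] at this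
  linarith

end Hilbert

/-! ### The tilted two-state chain: hyperbolic inequalities and the top eigenvalue. -/

section TwoState

/-- Hoeffding's lemma for a two-point distribution on `{-1, 1}` with mean `m`. -/
lemma cosh_add_mul_sinh_le_exp {m h : ℝ} (hm : |m| ≤ 1) :
    Real.cosh h + m * Real.sinh h ≤ Real.exp (m * h + h ^ 2 / 2) := by
  obtain ⟨hm1, hm2⟩ := abs_le.1 hm
  let μ : Measure ℝ := ENNReal.ofReal ((1 + m) / 2) • Measure.dirac 1 +
    ENNReal.ofReal ((1 - m) / 2) • Measure.dirac (-1)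
  have hμ : IsProbabilityMeasure μ := by
    constructor
    simp only [μ, Measure.add_apply, Measure.smul_apply, measure_univ, smul_eq_mul, mul_one]
    rw [← ENNReal.ofReal_add (by linarith) (by linarith)]
    ring_nf; simp
  have hint : ∀ (f : ℝ → ℝ), ∫ x, f x ∂μ = (1 + m) / 2 * f 1 + (1 - m) / 2 * f (-1) := by
    intro f
    have hi : ∀ (c a : ℝ), Integrable f (ENNReal.ofReal c • Measure.dirac a) := fun c a =>
      (integrable_dirac (by finiteness)).smul_measure ENNReal.ofReal_ne_top
    rw [integral_add_measure (hi _ _) (hi _ _)]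
    rw [integral_smul_measure, integral_smul_measure, integral_dirac, integral_dirac,
      ENNReal.toReal_ofReal (by linarith), ENNReal.toReal_ofReal (by linarith)]
    rfl
  have hX : ∀ᵐ x ∂μ, x ∈ Set.Icc (-1 : ℝ) 1 := by
    have : ∀ (c a : ℝ), a ∈ Set.Icc (-1 : ℝ) 1 →
        ∀ᵐ x ∂(ENNReal.ofReal c • Measure.dirac a), x ∈ Set.Icc (-1 : ℝ) 1 := fun c a ha =>
      Measure.ae_smul_measure (by rw [ae_dirac_eq]; exact ha) _
    rw [ae_add_measure_iff]
    exact ⟨this _ _ (by norm_num), this _ _ (by norm_num)⟩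
  have key := (hasSubgaussianMGF_of_mem_Icc (X := fun x : ℝ => x) aemeasurable_id hX).mgf_le h
  simp only [mgf, hint] at key
  have hc : (((‖(1 : ℝ) - -1‖₊ / 2) ^ 2 : NNReal) : ℝ) = 1 := by
    push_cast
    rw [Real.norm_eq_abs]; norm_num
  rw [hc] at key
  have h1 : (1 + m) / 2 * 1 + (1 - m) / 2 * -1 = m := by ring
  rw [h1] at key
  calc Real.cosh h + m * Real.sinh h
      = Real.exp (m * h) * ((1 + m) / 2 * Real.exp (h * (1 - m)) +
        (1 - m) / 2 * Real.exp (h * (-1 - m))) := by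
        rw [show h * (1 - m) = h + -(m * h) by ring, show h * (-1 - m) = -h + -(m * h) by ring,
          Real.exp_add, Real.exp_add, Real.exp_neg (m * h), Real.cosh_eq, Real.sinh_eq]
        field_simp
        ring
    _ ≤ Real.exp (m * h) * Real.exp (1 * h ^ 2 / 2) := by gcongr
    _ = _ := by rw [← Real.exp_add, one_mul]

/-- Beyond `m = 1` there is no two-point law. There `sinh h ≤ h e^h`, valid for all real `h`,
linearizes the excess `m - 1`, and `1 + x ≤ e^x` finishes. -/
lemma cosh_add_mul_sinh_le_exp_of_neg_one_le {m h : ℝ} (hm : -1 ≤ m) :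
    Real.cosh h + m * Real.sinh h ≤ Real.exp (m * h + h ^ 2 / 2) := by
  rcases le_total m 1 with h1 | h1
  · exact cosh_add_mul_sinh_le_exp (abs_le.2 ⟨hm, h1⟩)
  have h2 : Real.sinh h ≤ h * Real.exp h := by
    have h3 := Real.add_one_le_exp (-(2 * h))
    have h4 : Real.exp h * Real.exp (-(2 * h)) = Real.exp (-h) := by
      rw [← Real.exp_add]; ring_nf
    rw [Real.sinh_eq]
    nlinarith [Real.exp_pos h]
  calc Real.cosh h + m * Real.sinh h = Real.exp h + (m - 1) * Real.sinh h := by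
        rw [← Real.cosh_add_sinh]; ring
    _ ≤ Real.exp h + (m - 1) * (h * Real.exp h) := by gcongr
    _ ≤ Real.exp h * ((m - 1) * h + h ^ 2 / 2 + 1) := by nlinarith [Real.exp_pos h, sq_nonneg h]
    _ ≤ Real.exp h * Real.exp ((m - 1) * h + h ^ 2 / 2) := by
        gcongr; exact Real.add_one_le_exp _
    _ = _ := by rw [← Real.exp_add]; ring_nf

lemma sinh_le_mul_cosh {k : ℝ} (hk : 0 ≤ k) : Real.sinh k ≤ k * Real.cosh k := by
  rcases eq_or_lt_of_le hk with rfl | hk'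
  · simp
  obtain ⟨c, hc, hc'⟩ := exists_deriv_eq_slope Real.sinh hk' Real.continuous_sinh.continuousOn
    Real.differentiable_sinh.differentiableOn
  rw [Real.deriv_sinh, Real.sinh_zero, sub_zero, sub_zero] at hc'
  have h1 : Real.sinh k = k * Real.cosh c := by rw [hc']; field_simp
  rw [h1]
  gcongr
  rw [Real.cosh_le_cosh, abs_of_pos hc.1, abs_of_pos hk']
  exact hc.2.le

/-- In terms of the half angle `k = h / 2` this is `2 sinh² k ≤ 2 k sinh k cosh k`. -/
lemma cosh_sub_one_le {h : ℝ} (hh : 0 ≤ h) : Real.cosh h - 1 ≤ h / 2 * Real.sinh h := by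
  obtain ⟨k, rfl⟩ : ∃ k, h = 2 * k := ⟨h / 2, by ring⟩
  have hk : 0 ≤ k := by linarith
  rw [Real.cosh_two_mul, Real.sinh_two_mul, Real.cosh_sq]
  nlinarith [mul_le_mul_of_nonneg_left (sinh_le_mul_cosh hk) (Real.sinh_nonneg_iff.2 hk)]

/-- The bound for the logarithmic moment generating function of the two-state chain. -/
lemma mul_cosh_add_mul_sinh_le {R m h : ℝ} (hR : 1 ≤ R) (hm : |m| ≤ 1) :
    R * Real.cosh h + m * Real.sinh h ≤
      R * Real.cosh (m * h + R * h ^ 2 / 2) + Real.sinh (m * h + R * h ^ 2 / 2) := by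
  -- Both sides are invariant under `(m, h) ↦ (-m, -h)`.
  wlog hh : 0 ≤ h generalizing h m
  · have := this (m := -m) (h := -h) (by rwa [abs_neg]) (by linarith)
    simpa using this
  rcases eq_or_lt_of_le hh with rfl | hh'
  · simp
  -- The shifted mean is chosen so that the Hoeffding exponent becomes exactly `w = m h + R h² / 2`.
  -- It may exceed `1`, so the one-sided version is needed. What remains is `R - 1` times a
  -- nonnegative hyperbolic term.
  have hm' : -1 ≤ m + (R - 1) * h / 2 := by
    have := (abs_le.1 hm).1
    have : 0 ≤ (R - 1) * h := mul_nonneg (by linarith) hh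
    linarith
  have h1 := cosh_add_mul_sinh_le_exp_of_neg_one_le (h := h) hm'
  rw [show (m + (R - 1) * h / 2) * h + h ^ 2 / 2 = m * h + R * h ^ 2 / 2 by ring,
    ← Real.cosh_add_sinh] at h1
  set w := m * h + R * h ^ 2 / 2
  have h2 := cosh_sub_one_le hh
  have h3 := Real.one_le_cosh w
  have h4 : 0 ≤ (R - 1) * (Real.cosh w - Real.cosh h + h / 2 * Real.sinh h) :=
    mul_nonneg (by linarith) (by linarith)
  linarith

lemma quadratic_form_nonneg {a b c x y : ℝ} (ha : 0 ≤ a) (hc : 0 ≤ c) (h : b ^ 2 ≤ a * c) :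
    0 ≤ a * x ^ 2 - 2 * b * x * y + c * y ^ 2 := by
  rcases eq_or_lt_of_le ha with rfl | ha
  · have hb : b = 0 := by
      rw [zero_mul] at h
      exact pow_eq_zero_iff two_ne_zero |>.1 (le_antisymm h (sq_nonneg b))
    subst hb
    have := mul_nonneg hc (sq_nonneg y)
    linarith
  · refine nonneg_of_mul_nonneg_right (?_ : 0 ≤ a * _) ha
    have h1 := mul_le_mul_of_nonneg_right h (sq_nonneg y)
    have h2 := sq_nonneg (a * x - b * y)
    linarith

/-- A criterion for `q` to bound a binary quadratic form in terms of its characteristic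
polynomial. -/
lemma quadratic_form_le {a b c q x y : ℝ} (hq : 0 < q) (hdet : b ^ 2 ≤ (q - a) * (q - c))
    (hle : a * c - b ^ 2 ≤ q ^ 2) :
    a * x ^ 2 + 2 * b * x * y + c * y ^ 2 ≤ q * (x ^ 2 + y ^ 2) := by
  have h0 : 0 ≤ (q - a) * (q - c) := (sq_nonneg b).trans hdet
  -- A nonnegative characteristic polynomial only puts `q` outside the open interval between the
  -- eigenvalues; `det ≤ q²` puts it above their mean, hence above both.
  have hsum : a + c ≤ 2 * q := by
    have : q * (a + c - 2 * q) ≤ 0 := by linarith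
    have := nonpos_of_mul_nonpos_right this hq
    linarith
  have hac : 0 ≤ q - a ∧ 0 ≤ q - c := by
    rcases nonneg_and_nonneg_or_nonpos_and_nonpos_of_mul_nonneg h0 with h | h
    · exact h
    · constructor <;> linarith [h.1, h.2]
  have := quadratic_form_nonneg (x := x) (y := y) hac.1 hac.2 hdet
  linarith

/-- The quadratic form of the two-state chain `l • 1 + (1 - l) • 1 ⊗ p`, tilted by `e^t`, is
bounded by `exp (t p + t² (1 + l) / (8 (1 - l)))`. -/
lemma two_state_quadratic_le {l p t x y : ℝ} (hl0 : 0 ≤ l) (hl1 : l < 1) (hp0 : 0 ≤ p)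
    (hp1 : p ≤ 1) :
    l * (Real.exp t * x ^ 2 + y ^ 2) +
        (1 - l) * (Real.exp (t / 2) * √p * x + √(1 - p) * y) ^ 2 ≤
      Real.exp (t * p + t ^ 2 * ((1 + l) / (1 - l)) / 8) * (x ^ 2 + y ^ 2) := by
  obtain ⟨h, rfl⟩ : ∃ h, t = 2 * h := ⟨t / 2, by ring⟩
  have hl : 0 < 1 - l := by linarith
  set R := (1 + l) / (1 - l) with hRdef
  have hRl : R * (1 - l) = 1 + l := by rw [hRdef]; field_simp
  have hR : 1 ≤ R := by rw [hRdef, le_div_iff₀ hl]; linarith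
  set m := 2 * p - 1 with hmdef
  have hm : |m| ≤ 1 := abs_le.2 ⟨by linarith, by linarith⟩
  have key := mul_cosh_add_mul_sinh_le (h := h) hR hm
  set w := m * h + R * h ^ 2 / 2 with hw
  have hexp : Real.exp (2 * h * p + (2 * h) ^ 2 * R / 8) = Real.exp h * Real.exp w := by
    rw [← Real.exp_add, hw, hmdef]; ring_nf
  rw [hexp, show 2 * h / 2 = h by ring, show Real.exp (2 * h) = Real.exp h ^ 2 by
    rw [← Real.exp_nat_mul]; norm_num]
  set e := Real.exp h with he
  have hepos : 0 < e := Real.exp_pos h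
  set Z := Real.exp w with hZ
  have hZpos : 0 < Z := Real.exp_pos w
  have hee : e * Real.exp (-h) = 1 := by rw [he, ← Real.exp_add]; simp
  have hZZ : Z * Real.exp (-w) = 1 := by rw [hZ, ← Real.exp_add]; simp
  set r := √p
  set q := √(1 - p)
  have hr : r ^ 2 = p := Real.sq_sqrt hp0
  have hq : q ^ 2 = 1 - p := Real.sq_sqrt (by linarith)
  set Θ := e * Z with hΘdef
  have hΘ : 0 < Θ := by positivity
  set a := e ^ 2 * (l + (1 - l) * p) with ha
  set c := l + (1 - l) * (1 - p) with hc
  set b := (1 - l) * e * r * q with hb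
  have hb2 : b ^ 2 = (1 - l) ^ 2 * e ^ 2 * p * (1 - p) := by
    rw [hb, show ((1 - l) * e * r * q) ^ 2 = (1 - l) ^ 2 * e ^ 2 * r ^ 2 * q ^ 2 by ring, hr, hq]
  -- the characteristic polynomial at `Θ`
  have hdet : b ^ 2 ≤ (Θ - a) * (Θ - c) := by
    -- This factor turns `key` into `Θ · trace ≤ Θ² + det`, the determinant being `e² l`.
    have h1 := mul_le_mul_of_nonneg_left key (show 0 ≤ e ^ 2 * Z * (1 - l) by positivity)
    rw [Real.cosh_eq, Real.sinh_eq, Real.cosh_eq, Real.sinh_eq, ← he, ← hZ] at h1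
    have h2 : e ^ 2 * Z * (1 - l) * (R * ((e + Real.exp (-h)) / 2) +
        m * ((e - Real.exp (-h)) / 2)) = Θ * (a + c) := by
      have : e ^ 2 * Z * (1 - l) * (R * ((e + Real.exp (-h)) / 2) +
        m * ((e - Real.exp (-h)) / 2)) = e * Z / 2 * ((R * (1 - l)) * (e ^ 2 + e * Real.exp (-h)) +
        m * (1 - l) * (e ^ 2 - e * Real.exp (-h))) := by ring
      rw [this, hRl, hee, ha, hc, hmdef, hΘdef]; ring
    have h3 : e ^ 2 * Z * (1 - l) * (R * ((Z + Real.exp (-w)) / 2) +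
        (Z - Real.exp (-w)) / 2) = Θ ^ 2 + e ^ 2 * l := by
      have : e ^ 2 * Z * (1 - l) * (R * ((Z + Real.exp (-w)) / 2) +
        (Z - Real.exp (-w)) / 2) = e ^ 2 / 2 * ((R * (1 - l)) * (Z ^ 2 + Z * Real.exp (-w)) +
        (1 - l) * (Z ^ 2 - Z * Real.exp (-w))) := by ring
      rw [this, hRl, hZZ, hΘdef]; ring
    rw [h2, h3] at h1
    rw [hb2]
    have h4 : a * c - (1 - l) ^ 2 * e ^ 2 * p * (1 - p) = e ^ 2 * l := by rw [ha, hc]; ring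
    linarith
  -- `Θ² ≥ det`
  have hZl : l ≤ Z ^ 2 := by
    have h1 : 1 + 2 * w ≤ Z ^ 2 := by
      have := Real.add_one_le_exp (2 * w)
      rw [show Real.exp (2 * w) = Z ^ 2 by rw [hZ, ← Real.exp_nat_mul]; norm_num] at this
      linarith
    -- Completing the square in `h`: the minimum of `2 w` is `-m² / R`.
    have h2 : -(1 - l) ≤ 2 * w := by
      have h5 : (1 + l) * (2 * w) = (1 - l) * ((R * h + m) ^ 2 - m ^ 2) := by
        rw [hw, ← hRl]; ring
      have h6 : m ^ 2 ≤ 1 := (sq_le_one_iff_abs_le_one m).2 hm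
      nlinarith [sq_nonneg (R * h + m)]
    linarith
  have h4 : a * c - b ^ 2 ≤ Θ ^ 2 := by
    have : a * c - b ^ 2 = e ^ 2 * l := by rw [hb2, ha, hc]; ring
    rw [this, show Θ ^ 2 = e ^ 2 * Z ^ 2 by rw [hΘdef]; ring]
    gcongr
  have hexpand : l * (e ^ 2 * x ^ 2 + y ^ 2) + (1 - l) * (e * r * x + q * y) ^ 2 =
      a * x ^ 2 + 2 * b * x * y + c * y ^ 2 := by
    have : (e * r * x + q * y) ^ 2 =
        e ^ 2 * r ^ 2 * x ^ 2 + 2 * e * r * q * x * y + q ^ 2 * y ^ 2 := by ring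
    rw [this, hr, hq, ha, hb, hc]; ring
  rw [hexpand]
  exact quadratic_form_le hΘ hdet h4

end TwoState

/-! ### The Markov operator of a reversible kernel on `L₂` and on `L₂⁰`. -/

section ReversibleOperator

open scoped InnerProductSpace

variable {X : Type*} [MeasurableSpace X] {K : Kernel X X} [IsMarkovKernel K] {π : Measure X}
  [IsProbabilityMeasure π]

/-- Reversibility is symmetry of the joint law of two consecutive stationary states on rectangles,
and rectangles determine a finite measure. -/
lemma map_swap_compProd (hrev : K.IsReversible π) : (π ⊗ₘ K).map Prod.swap = π ⊗ₘ K := by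
  have := Measure.isFiniteMeasure_map (π ⊗ₘ K) Prod.swap
  refine Measure.ext_prod fun {s t} hs ht => ?_
  rw [Measure.map_apply measurable_swap (hs.prod ht), Set.preimage_swap_prod,
    Measure.compProd_apply_prod ht hs, Measure.compProd_apply_prod hs ht, hrev ht hs]

lemma measurePreserving_fst_compProd : MeasurePreserving Prod.fst (π ⊗ₘ K) π :=
  ⟨measurable_fst, by rw [← Measure.fst, Measure.fst_compProd]⟩

lemma measurePreserving_snd_compProd (hK : K.Invariant π) :
    MeasurePreserving Prod.snd (π ⊗ₘ K) π :=
  ⟨measurable_snd, by rw [← Measure.snd, Measure.snd_compProd, hK.def]⟩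

lemma integrable_mul_compProd (hK : K.Invariant π) {f g : X → ℝ} (hf : MemLp f 2 π)
    (hg : MemLp g 2 π) : Integrable (fun p : X × X => g p.1 * f p.2) (π ⊗ₘ K) :=
  (hg.comp_measurePreserving measurePreserving_fst_compProd).integrable_mul
    (hf.comp_measurePreserving (measurePreserving_snd_compProd hK))

lemma integral_mul_compProd (hK : K.Invariant π) {f g : X → ℝ} (hf : MemLp f 2 π)
    (hg : MemLp g 2 π) :
    ∫ p, g p.1 * f p.2 ∂(π ⊗ₘ K) = ∫ x, g x * ∫ y, f y ∂K x ∂π := by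
  rw [Measure.integral_compProd (integrable_mul_compProd hK hf hg)]
  simp only [integral_const_mul]

/-- The detailed balance relation `⟨g, P f⟩ = ⟨P g, f⟩`. -/
lemma integral_mul_kernel_comm (hrev : K.IsReversible π) {f g : X → ℝ} (hf : MemLp f 2 π)
    (hg : MemLp g 2 π) :
    ∫ x, g x * ∫ y, f y ∂K x ∂π = ∫ x, f x * ∫ y, g y ∂K x ∂π := by
  rw [← integral_mul_compProd hrev.invariant hf hg, ← integral_mul_compProd hrev.invariant hg hf]
  have hae : AEStronglyMeasurable (fun p : X × X => f p.1 * g p.2) ((π ⊗ₘ K).map Prod.swap) := by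
    rw [map_swap_compProd hrev]
    exact (integrable_mul_compProd hrev.invariant hg hf).1
  conv_rhs => rw [← map_swap_compProd hrev, integral_map measurable_swap.aemeasurable hae]
  simp only [Prod.fst_swap, Prod.snd_swap, mul_comm]

lemma inner_markovOp (hK : K.Invariant π) (f g : Lp ℝ 2 π) :
    ⟪markovOp K π hK f, g⟫_ℝ = ∫ x, g x * ∫ y, f y ∂K x ∂π := by
  rw [L2.inner_def]
  refine integral_congr_ae ?_
  filter_upwards [markovOp_coeFn K π hK f] with x hx
  rw [hx]; rfl

lemma isSymmetric_markovOp (hrev : K.IsReversible π) :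
    (markovOp K π hrev.invariant : Lp ℝ 2 π →ₗ[ℝ] Lp ℝ 2 π).IsSymmetric := by
  intro f g
  simp only [ContinuousLinearMap.coe_coe]
  rw [inner_markovOp, real_inner_comm, inner_markovOp,
    integral_mul_kernel_comm hrev (Lp.memLp f) (Lp.memLp g)]

lemma norm_markovOp_apply_le (hK : K.Invariant π) (f : Lp ℝ 2 π) :
    ‖markovOp K π hK f‖ ≤ ‖f‖ := by
  have h : ‖markovOp K π hK‖ ≤ 1 := LinearMap.mkContinuous_norm_le _ zero_le_one _
  simpa using (markovOp K π hK).le_of_opNorm_le h f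

/-- The constant function `1` in `L₂`. -/
def oneL2 (π : Measure X) [IsProbabilityMeasure π] : Lp ℝ 2 π :=
  (memLp_const (1 : ℝ)).toLp (fun _ => 1)

lemma coeFn_oneL2 : oneL2 π =ᵐ[π] fun _ => (1 : ℝ) := MemLp.coeFn_toLp _

lemma markovOp_oneL2 (hK : K.Invariant π) : markovOp K π hK (oneL2 π) = oneL2 π := by
  refine Lp.ext ?_
  have h1 : ∀ᵐ x ∂(π.bind K), oneL2 π x = 1 := by rw [hK.def]; exact coeFn_oneL2
  filter_upwards [markovOp_coeFn K π hK (oneL2 π), coeFn_oneL2 (π := π),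
    Measure.ae_ae_of_ae_comp h1] with x hx hx1 hx2
  rw [hx, hx1, integral_congr_ae hx2]; simp

lemma inner_oneL2 (f : Lp ℝ 2 π) : ⟪oneL2 π, f⟫_ℝ = ∫ x, f x ∂π := by
  rw [L2.inner_def]
  refine integral_congr_ae ?_
  filter_upwards [coeFn_oneL2 (π := π)] with x hx
  rw [hx]; simp

lemma norm_oneL2_sq : ‖oneL2 π‖ ^ 2 = 1 := by
  rw [← real_inner_self_eq_norm_sq, inner_oneL2, integral_congr_ae coeFn_oneL2]; simp

lemma norm_oneL2 : ‖oneL2 π‖ = 1 :=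
  (pow_eq_one_iff_of_nonneg (norm_nonneg _) two_ne_zero).1 norm_oneL2_sq

lemma mem_L20_iff (f : Lp ℝ 2 π) : f ∈ L20 π ↔ ⟪oneL2 π, f⟫_ℝ = 0 := by
  rw [inner_oneL2]; rfl

instance completeSpace_L20 : CompleteSpace (L20 π) := by
  have h : IsClosed (L20 π : Set (Lp ℝ 2 π)) := by
    have h1 : (L20 π : Set (Lp ℝ 2 π)) = {f | ⟪oneL2 π, f⟫_ℝ = 0} := by
      ext f; exact mem_L20_iff f
    rw [h1]
    exact isClosed_eq (continuous_const.inner continuous_id) continuous_const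
  exact h.completeSpace_coe

lemma coe_markovOp0_apply (hK : K.Invariant π) (f : L20 π) :
    (markovOp0 K π hK f : Lp ℝ 2 π) = markovOp K π hK f := rfl

lemma coe_markovOp0_pow_apply (hK : K.Invariant π) (f : L20 π) (n : ℕ) :
    (((markovOp0 K π hK) ^ n) f : Lp ℝ 2 π) = ((markovOp K π hK) ^ n) f := by
  induction n with
  | zero => rfl
  | succ n ih =>
    rw [pow_succ', pow_succ', mul_apply_eq_comp, mul_apply_eq_comp,
      coe_markovOp0_apply, ih]

lemma isSymmetric_markovOp0 (hrev : K.IsReversible π) :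
    (markovOp0 K π hrev.invariant : L20 π →ₗ[ℝ] L20 π).IsSymmetric := fun f g =>
  isSymmetric_markovOp hrev (f : Lp ℝ 2 π) g

lemma inner_markovOp0_le (hrev : K.IsReversible π) (f : L20 π) :
    ⟪markovOp0 K π hrev.invariant f, f⟫_ℝ ≤
      max 0 (specSup K π hrev.invariant) * ‖f‖ ^ 2 :=
  (inner_le_sSup_spectrum (isSymmetric_markovOp0 hrev) f).trans
    (mul_le_mul_of_nonneg_right (le_max_right _ _) (sq_nonneg _))

lemma neg_norm_sq_le_inner_markovOp0 (hK : K.Invariant π) (f : L20 π) :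
    -‖f‖ ^ 2 ≤ ⟪markovOp0 K π hK f, f⟫_ℝ := by
  have h1 := abs_real_inner_le_norm (markovOp0 K π hK f) f
  have h2 : ‖markovOp0 K π hK f‖ ≤ ‖f‖ := norm_markovOp_apply_le hK (f : Lp ℝ 2 π)
  have h3 := (abs_le.1 h1).1
  nlinarith [norm_nonneg f]

lemma abs_specSup_le (hrev : K.IsReversible π) :
    |specSup K π hrev.invariant| ≤ opNorm0 K π hrev.invariant :=
  abs_sSup_spectrum_le (isSymmetric_markovOp0 hrev)

lemma norm_sum_markovOp0_pow_le (hrev : K.IsReversible π) (n : ℕ) (f : L20 π) :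
    ‖∑ j ∈ Finset.range n, (markovOp0 K π hrev.invariant ^ j) f‖ ≤
      (∑ j ∈ Finset.range n, max 0 (specSup K π hrev.invariant) ^ j) * ‖f‖ := by
  have := norm_geom_sum_apply_le (le_max_left 0 (specSup K π hrev.invariant))
    (ContinuousLinearMap.isSelfAdjoint_iff_isSymmetric.2 (isSymmetric_markovOp0 hrev))
    (neg_norm_sq_le_inner_markovOp0 hrev.invariant) (inner_markovOp0_le hrev) n f
  rwa [sum_apply] at this

lemma norm_markovOp0_pow_apply_le (hK : K.Invariant π) (n : ℕ) (f : L20 π) :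
    ‖(markovOp0 K π hK ^ n) f‖ ≤ opNorm0 K π hK ^ n * ‖f‖ := by
  induction n with
  | zero => simp
  | succ n ih =>
    rw [pow_succ', mul_apply_eq_comp, pow_succ', mul_assoc]
    exact ((markovOp0 K π hK).le_opNorm _).trans (mul_le_mul_of_nonneg_left ih (norm_nonneg (markovOp0 K π hK)))

/-- `P ≤ l • 1 + (1 - l) • Π` with `l = max 0 Λ` and `Π` the projection on the constants. -/
lemma inner_markovOp_le (hrev : K.IsReversible π) {l : ℝ}
    (hl : l = max 0 (specSup K π hrev.invariant)) (f : Lp ℝ 2 π) :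
    ⟪markovOp K π hrev.invariant f, f⟫_ℝ ≤ l * ‖f‖ ^ 2 + (1 - l) * (∫ x, f x ∂π) ^ 2 := by
  set c := ∫ x, f x ∂π with hc
  have h11 : ⟪oneL2 π, oneL2 π⟫_ℝ = 1 := by rw [real_inner_self_eq_norm_sq, norm_oneL2_sq]
  have hmem : f - c • oneL2 π ∈ L20 π := by
    rw [mem_L20_iff, inner_sub_right, inner_smul_right, h11, inner_oneL2]; simp [hc]
  -- `P` fixes the constants and preserves `L₂⁰`, so all cross terms vanish in this orthogonal
  -- splitting.
  obtain ⟨g, hg⟩ : ∃ g : L20 π, f = c • oneL2 π + g := ⟨⟨_, hmem⟩, by simp⟩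
  have h1g : ⟪oneL2 π, (g : Lp ℝ 2 π)⟫_ℝ = 0 := (mem_L20_iff _).1 g.2
  have hg1 : ⟪(g : Lp ℝ 2 π), oneL2 π⟫_ℝ = 0 := by rw [real_inner_comm, h1g]
  have hP : ⟪markovOp K π hrev.invariant (g : Lp ℝ 2 π), oneL2 π⟫_ℝ = 0 := by
    rw [real_inner_comm]
    exact (mem_L20_iff _).1 (markovOp_mem_L20 K π hrev.invariant _ g.2)
  have hn : ‖f‖ ^ 2 = c ^ 2 + ‖g‖ ^ 2 := by
    rw [← real_inner_self_eq_norm_sq, hg]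
    simp only [inner_add_left, inner_add_right, inner_smul_left, inner_smul_right, h11, h1g, hg1,
      RCLike.conj_to_real, real_inner_self_eq_norm_sq]
    simp; ring
  have hPf : ⟪markovOp K π hrev.invariant f, f⟫_ℝ =
      c ^ 2 + ⟪markovOp0 K π hrev.invariant g, g⟫_ℝ := by
    rw [hg, map_add, map_smul, markovOp_oneL2]
    simp only [inner_add_left, inner_add_right, inner_smul_left, inner_smul_right, h11, h1g, hP,
      RCLike.conj_to_real]
    simp [coe_markovOp0_apply]; ring
  have := inner_markovOp0_le hrev g
  rw [← hl] at this
  rw [hPf, hn]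
  linarith

end ReversibleOperator

/-! ### Bounded measurable functions, on which tilting and the kernel act pointwise. -/

section BoundedMeasurable

variable {X : Type*} [MeasurableSpace X]

/-- Bounded measurable real functions. -/
def BddMeas (g : X → ℝ) : Prop := Measurable g ∧ ∃ C, ∀ x, |g x| ≤ C

namespace BddMeas

variable {f g : X → ℝ}

lemma mul (hf : BddMeas f) (hg : BddMeas g) : BddMeas (fun x => f x * g x) := by
  obtain ⟨hfm, C, hC⟩ := hf
  obtain ⟨hgm, D, hD⟩ := hg
  refine ⟨hfm.mul hgm, C * D, fun x => ?_⟩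
  rw [abs_mul]
  exact mul_le_mul (hC x) (hD x) (abs_nonneg _) ((abs_nonneg _).trans (hC x))

lemma add (hf : BddMeas f) (hg : BddMeas g) : BddMeas (fun x => f x + g x) := by
  obtain ⟨hfm, C, hC⟩ := hf
  obtain ⟨hgm, D, hD⟩ := hg
  exact ⟨hfm.add hgm, C + D, fun x => (abs_add_le _ _).trans (add_le_add (hC x) (hD x))⟩

lemma const (c : ℝ) : BddMeas (fun _ : X => c) := ⟨measurable_const, |c|, fun _ => le_rfl⟩

lemma const_mul (c : ℝ) (hf : BddMeas f) : BddMeas (fun x => c * f x) := (const c).mul hf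

lemma abs (hf : BddMeas f) : BddMeas (fun x => |f x|) := by
  obtain ⟨hfm, C, hC⟩ := hf
  exact ⟨hfm.abs, C, fun x => by rw [abs_abs]; exact hC x⟩

lemma sq (hf : BddMeas f) : BddMeas (fun x => f x ^ 2) := by
  simpa only [_root_.sq] using hf.mul hf

lemma memLp (hf : BddMeas f) (p : ℝ≥0∞) (μ : Measure X) [IsFiniteMeasure μ] : MemLp f p μ := by
  obtain ⟨hfm, C, hC⟩ := hf
  exact MemLp.of_bound hfm.aestronglyMeasurable C (ae_of_all _ hC)

lemma integrable (hf : BddMeas f) (μ : Measure X) [IsFiniteMeasure μ] : Integrable f μ :=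
  memLp_one_iff_integrable.1 (hf.memLp 1 μ)

lemma integral_kernel (hf : BddMeas f) (K : Kernel X X) [IsMarkovKernel K] :
    BddMeas (fun x => ∫ y, f y ∂K x) := by
  obtain ⟨hfm, C, hC⟩ := hf
  refine ⟨(hfm.stronglyMeasurable.integral_kernel).measurable, C, fun x => ?_⟩
  have := norm_integral_le_of_norm_le_const (μ := K x) (f := f) (ae_of_all _ hC)
  simpa using this

end BddMeas

/-- Cauchy-Schwarz for integrals. -/
lemma integral_mul_sq_le {μ : Measure X} {f g : X → ℝ} (hf : MemLp f 2 μ) (hg : MemLp g 2 μ) :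
    (∫ x, f x * g x ∂μ) ^ 2 ≤ (∫ x, f x ^ 2 ∂μ) * ∫ x, g x ^ 2 ∂μ := by
  have h : ∀ s : ℝ, 0 ≤ (∫ x, g x ^ 2 ∂μ) * (s * s) + (2 * ∫ x, f x * g x ∂μ) * s +
      ∫ x, f x ^ 2 ∂μ := by
    intro s
    have h1 : 0 ≤ ∫ x, (f x + s * g x) ^ 2 ∂μ := integral_nonneg fun x => sq_nonneg _
    have h2 : ∫ x, (f x + s * g x) ^ 2 ∂μ =
        ∫ x, (s * s * g x ^ 2 + 2 * s * (f x * g x) + f x ^ 2) ∂μ := by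
      congr 1; ext x; ring
    have hfg : Integrable (fun x => f x * g x) μ := hf.integrable_mul hg
    rw [h2, integral_add ((hg.integrable_sq.const_mul _).fun_add (hfg.const_mul _)) hf.integrable_sq,
      integral_add (hg.integrable_sq.const_mul _) (hfg.const_mul _), integral_const_mul,
      integral_const_mul] at h1
    linarith
  have := discrim_le_zero h
  rw [discrim] at this
  linarith

lemma setIntegral_abs_le {μ : Measure X} [IsFiniteMeasure μ] {g : X → ℝ} (hg : BddMeas g)
    (A : Set X) : ∫ x in A, |g x| ∂μ ≤ √(μ.real A) * √(∫ x in A, g x ^ 2 ∂μ) := by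
  have h := integral_mul_sq_le (μ := μ.restrict A) ((BddMeas.const 1).memLp 2 _)
    (hg.abs.memLp 2 (μ.restrict A))
  simp only [one_mul, sq_abs, one_pow, integral_const, smul_eq_mul, mul_one,
    measureReal_restrict_apply_univ] at h
  rw [← Real.sqrt_mul measureReal_nonneg]
  exact Real.le_sqrt_of_sq_le h

end BoundedMeasurable

/-! ### Tilted operators and the stationary moment generating function. -/

section Tilted

open scoped InnerProductSpace

variable {X : Type*}

/-- The function `exp (t 1_A)`. -/
def tilt (A : Set X) (t : ℝ) (x : X) : ℝ := Real.exp (t * A.indicator (fun _ => 1) x)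

lemma tilt_of_mem {A : Set X} {x : X} (hx : x ∈ A) (t : ℝ) : tilt A t x = Real.exp t := by
  simp [tilt, hx]

lemma tilt_of_notMem {A : Set X} {x : X} (hx : x ∉ A) (t : ℝ) : tilt A t x = 1 := by
  simp [tilt, hx]

lemma tilt_pos (A : Set X) (t : ℝ) (x : X) : 0 < tilt A t x := Real.exp_pos _

lemma tilt_mul_tilt (A : Set X) (s t : ℝ) (x : X) :
    tilt A s x * tilt A t x = tilt A (s + t) x := by
  rw [tilt, tilt, tilt, ← Real.exp_add, add_mul]

variable [MeasurableSpace X]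

lemma measurable_tilt {A : Set X} (hA : MeasurableSet A) (t : ℝ) : Measurable (tilt A t) :=
  Real.measurable_exp.comp ((measurable_const.indicator hA).const_mul t)

lemma bddMeas_tilt {A : Set X} (hA : MeasurableSet A) (t : ℝ) : BddMeas (tilt A t) := by
  refine ⟨measurable_tilt hA t, max (Real.exp t) 1, fun x => ?_⟩
  rw [abs_of_pos (tilt_pos A t x)]
  by_cases hx : x ∈ A
  · rw [tilt_of_mem hx]; exact le_max_left _ _
  · rw [tilt_of_notMem hx]; exact le_max_right _ _

lemma integral_tilt_mul {μ : Measure X} [IsFiniteMeasure μ] {A : Set X} (hA : MeasurableSet A)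
    (t : ℝ) {g : X → ℝ} (hg : BddMeas g) :
    ∫ x, tilt A t x * g x ∂μ = Real.exp t * (∫ x in A, g x ∂μ) + ∫ x in Aᶜ, g x ∂μ := by
  rw [← integral_add_compl hA (((bddMeas_tilt hA t).mul hg).integrable μ), ← integral_const_mul]
  congr 1
  · exact setIntegral_congr_fun hA fun x hx => by simp only [tilt_of_mem hx]
  · exact setIntegral_congr_fun hA.compl fun x hx => by simp only [tilt_of_notMem hx, one_mul]

variable {K : Kernel X X} [IsMarkovKernel K] {π : Measure X} [IsProbabilityMeasure π]

lemma integral_mul_kernel_self_le (hrev : K.IsReversible π) {l : ℝ}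
    (hl : l = max 0 (specSup K π hrev.invariant)) {g : X → ℝ} (hg : MemLp g 2 π) :
    ∫ x, g x * ∫ y, g y ∂K x ∂π ≤ l * ∫ x, g x ^ 2 ∂π + (1 - l) * (∫ x, g x ∂π) ^ 2 := by
  have h := inner_markovOp_le hrev hl (hg.toLp g)
  have hg' := hg.coeFn_toLp
  -- Invariance makes the choice of representative harmless under the kernel: equality `π`-a.e. is
  -- equality `K x`-a.e. for almost every `x`.
  have hK : ∀ᵐ y ∂(π.bind K), hg.toLp g y = g y := by rw [hrev.invariant.def]; exact hg'
  have e1 : ∫ x, hg.toLp g x * ∫ y, hg.toLp g y ∂K x ∂π = ∫ x, g x * ∫ y, g y ∂K x ∂π := by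
    refine integral_congr_ae ?_
    filter_upwards [hg', Measure.ae_ae_of_ae_comp hK] with x hx hxK
    rw [hx, integral_congr_ae hxK]
  have e2 : ‖hg.toLp g‖ ^ 2 = ∫ x, g x ^ 2 ∂π := by
    rw [← real_inner_self_eq_norm_sq, L2.inner_def]
    refine integral_congr_ae ?_
    filter_upwards [hg'] with x hx
    rw [hx, real_inner_self_eq_norm_sq, Real.norm_eq_abs, sq_abs]
  rwa [inner_markovOp, e1, e2,
    (integral_congr_ae hg' : ∫ x, hg.toLp g x ∂π = ∫ x, g x ∂π)] at h

/-- The constant `exp (t p + t² (1 + l) / (8 (1 - l)))`. -/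
def tiltBound (l p t : ℝ) : ℝ := Real.exp (t * p + t ^ 2 * ((1 + l) / (1 - l)) / 8)

lemma tiltBound_pos (l p t : ℝ) : 0 < tiltBound l p t := Real.exp_pos _

/-- Replacing `g` by `|g|` only increases the form, because the kernel is positive, so the one-sided
bound on `P` suffices. Cauchy-Schwarz on `A` and `Aᶜ` then leaves the two-state form in the
`L₂`-norms of `g` on the two pieces. -/
lemma abs_integral_tilt_le (hrev : K.IsReversible π) {l : ℝ}
    (hl : l = max 0 (specSup K π hrev.invariant)) (hl1 : l < 1) {A : Set X}
    (hA : MeasurableSet A) (t : ℝ) {g : X → ℝ} (hg : BddMeas g) :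
    |∫ x, (tilt A (t / 2) x * g x) * ∫ y, tilt A (t / 2) y * g y ∂K x ∂π| ≤
      tiltBound l (π.real A) t * ∫ x, g x ^ 2 ∂π := by
  have hl0 : 0 ≤ l := hl ▸ le_max_left _ _
  have hE := bddMeas_tilt hA (t / 2)
  set G : X → ℝ := fun x => tilt A (t / 2) x * |g x| with hGdef
  have hG : BddMeas G := hE.mul hg.abs
  have hG0 : ∀ x, 0 ≤ G x := fun x => mul_nonneg (tilt_pos _ _ _).le (abs_nonneg _)
  have habs : ∀ x, |tilt A (t / 2) x * g x| = G x := fun x => by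
    rw [abs_mul, abs_of_pos (tilt_pos _ _ _)]
  have h1 : |∫ x, (tilt A (t / 2) x * g x) * ∫ y, tilt A (t / 2) y * g y ∂K x ∂π| ≤
      ∫ x, G x * ∫ y, G y ∂K x ∂π := by
    refine abs_integral_le_integral_abs.trans (integral_mono
      (((hE.mul hg).mul ((hE.mul hg).integral_kernel K)).abs.integrable π)
      ((hG.mul (hG.integral_kernel K)).integrable π) fun x => ?_)
    dsimp only
    rw [abs_mul, habs]
    refine mul_le_mul_of_nonneg_left (abs_integral_le_integral_abs.trans_eq ?_) (hG0 x)
    simp only [habs]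
  refine h1.trans ((integral_mul_kernel_self_le hrev hl (hG.memLp 2 π)).trans ?_)
  have h2 : ∫ x, G x ^ 2 ∂π =
      Real.exp t * (∫ x in A, g x ^ 2 ∂π) + ∫ x in Aᶜ, g x ^ 2 ∂π := by
    rw [← integral_tilt_mul hA t hg.sq]
    congr 1; ext x
    rw [hGdef, mul_pow, sq_abs, sq (tilt _ _ _), tilt_mul_tilt, add_halves]
  have h3 : ∫ x, G x ∂π ≤ Real.exp (t / 2) * √(π.real A) * √(∫ x in A, g x ^ 2 ∂π) +
      √(1 - π.real A) * √(∫ x in Aᶜ, g x ^ 2 ∂π) := by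
    rw [integral_tilt_mul hA (t / 2) hg.abs, mul_assoc, ← probReal_compl_eq_one_sub hA]
    gcongr <;> exact setIntegral_abs_le hg _
  have h4 : ∀ B, √(∫ x in B, g x ^ 2 ∂π) ^ 2 = ∫ x in B, g x ^ 2 ∂π := fun B =>
    Real.sq_sqrt (integral_nonneg fun x => sq_nonneg _)
  have h5 := two_state_quadratic_le (t := t) (x := √(∫ x in A, g x ^ 2 ∂π))
    (y := √(∫ x in Aᶜ, g x ^ 2 ∂π)) hl0 hl1 (measureReal_nonneg (μ := π) (s := A))
    measureReal_le_one
  rw [h4, h4, integral_add_compl hA (hg.sq.integrable π)] at h5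
  refine le_trans ?_ h5
  rw [h2]
  have h6 : 0 ≤ ∫ x, G x ∂π := integral_nonneg hG0
  have : 0 ≤ 1 - l := by linarith
  gcongr

/-- The operator `exp(t 1_A / 2) P exp(t 1_A / 2)`. -/
def tiltOp (K : Kernel X X) (A : Set X) (t : ℝ) (g : X → ℝ) (x : X) : ℝ :=
  tilt A (t / 2) x * ∫ y, tilt A (t / 2) y * g y ∂K x

lemma bddMeas_tiltOp {A : Set X} (hA : MeasurableSet A) (t : ℝ) {g : X → ℝ} (hg : BddMeas g) :
    BddMeas (tiltOp K A t g) :=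
  (bddMeas_tilt hA _).mul (((bddMeas_tilt hA _).mul hg).integral_kernel K)

/-- Norm and numerical radius agree for symmetric operators. Polarization with `u = T g` and `v = Θ
g`, for `T` the tilted operator, proves this directly on bounded functions. -/
lemma integral_tiltOp_sq_le (hrev : K.IsReversible π) {l : ℝ}
    (hl : l = max 0 (specSup K π hrev.invariant)) (hl1 : l < 1) {A : Set X}
    (hA : MeasurableSet A) (t : ℝ) {g : X → ℝ} (hg : BddMeas g) :
    ∫ x, tiltOp K A t g x ^ 2 ∂π ≤ tiltBound l (π.real A) t ^ 2 * ∫ x, g x ^ 2 ∂π := by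
  set Θ := tiltBound l (π.real A) t
  have hΘ : 0 < Θ := tiltBound_pos _ _ _
  have hE := bddMeas_tilt hA (t / 2)
  have hu := bddMeas_tiltOp (K := K) hA t hg
  set u := tiltOp K A t g with hudef
  set v : X → ℝ := fun x => Θ * g x with hvdef
  have hv : BddMeas v := hg.const_mul Θ
  set U : X → ℝ := fun x => tilt A (t / 2) x * u x
  set V : X → ℝ := fun x => tilt A (t / 2) x * v x
  have hU : BddMeas U := hE.mul hu
  have hV : BddMeas V := hE.mul hv
  have hUK := hU.integral_kernel K
  have hVK := hV.integral_kernel K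
  have hplus := (abs_le.1 (abs_integral_tilt_le hrev hl hl1 hA t (hu.add hv))).2
  have hminus := (abs_le.1 (abs_integral_tilt_le hrev hl hl1 hA t
    (hu.add (hv.const_mul (-1))))).1
  have e1 : ∫ x, (u x + v x) ^ 2 ∂π =
      ∫ x, u x ^ 2 ∂π + 2 * (∫ x, u x * v x ∂π) + ∫ x, v x ^ 2 ∂π := by
    have : ∀ x, (u x + v x) ^ 2 = u x ^ 2 + 2 * (u x * v x) + v x ^ 2 := fun x => by ring
    simp only [this]
    rw [integral_add ((hu.sq.integrable π).fun_add (((hu.mul hv).integrable π).const_mul 2))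
      (hv.sq.integrable π), integral_add (hu.sq.integrable π)
      (((hu.mul hv).integrable π).const_mul 2), integral_const_mul]
  have e2 : ∫ x, (u x + -1 * v x) ^ 2 ∂π =
      ∫ x, u x ^ 2 ∂π + (-2) * (∫ x, u x * v x ∂π) + ∫ x, v x ^ 2 ∂π := by
    have : ∀ x, (u x + -1 * v x) ^ 2 = u x ^ 2 + (-2) * (u x * v x) + v x ^ 2 := fun x => by ring
    simp only [this]
    rw [integral_add ((hu.sq.integrable π).fun_add (((hu.mul hv).integrable π).const_mul (-2)))
      (hv.sq.integrable π), integral_add (hu.sq.integrable π)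
      (((hu.mul hv).integrable π).const_mul (-2)), integral_const_mul]
  have e3 : ∀ s : ℝ, ∫ x, (tilt A (t / 2) x * (u x + s * v x)) *
      ∫ y, tilt A (t / 2) y * (u y + s * v y) ∂K x ∂π =
      ∫ x, U x * ∫ y, U y ∂K x ∂π + 2 * s * (∫ x, U x * ∫ y, V y ∂K x ∂π) +
        s ^ 2 * ∫ x, V x * ∫ y, V y ∂K x ∂π := by
    intro s
    have h1 : ∀ x, tilt A (t / 2) x * (u x + s * v x) = U x + s * V x := fun x => by
      simp only [U, V]; ring
    have h2 : ∀ x, ∫ y, (U y + s * V y) ∂K x = ∫ y, U y ∂K x + s * ∫ y, V y ∂K x := fun x => by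
      rw [integral_add (hU.integrable _) ((hV.integrable _).const_mul s), integral_const_mul]
    have h3 : ∀ x, (U x + s * V x) * (∫ y, U y ∂K x + s * ∫ y, V y ∂K x) =
        U x * (∫ y, U y ∂K x) + s * (U x * ∫ y, V y ∂K x) + s * (V x * ∫ y, U y ∂K x) +
          s ^ 2 * (V x * ∫ y, V y ∂K x) := fun x => by ring
    simp only [h1, h2, h3]
    have i1 := (hU.mul hUK).integrable π
    have i2 := ((hU.mul hVK).integrable π).const_mul s
    have i3 := ((hV.mul hUK).integrable π).const_mul s
    have i4 := ((hV.mul hVK).integrable π).const_mul (s ^ 2)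
    rw [integral_add ((i1.fun_add i2).fun_add i3) i4, integral_add (i1.fun_add i2) i3, integral_add i1 i2,
      integral_const_mul, integral_const_mul, integral_const_mul,
      integral_mul_kernel_comm hrev (hU.memLp 2 π) (hV.memLp 2 π)]
    ring
  have e4 : ∫ x, U x * ∫ y, V y ∂K x ∂π = Θ * ∫ x, u x ^ 2 ∂π := by
    rw [← integral_const_mul]
    congr 1; ext x
    have : ∫ y, V y ∂K x = Θ * ∫ y, tilt A (t / 2) y * g y ∂K x := by
      rw [← integral_const_mul]
      congr 1; ext y
      simp only [V, v]; ring
    rw [this]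
    simp only [U, sq, hudef, tiltOp]
    ring
  have e5 : ∫ x, v x ^ 2 ∂π = Θ ^ 2 * ∫ x, g x ^ 2 ∂π := by
    rw [← integral_const_mul]
    simp only [hvdef, mul_pow]
  have e31 := e3 1
  have e3m := e3 (-1)
  simp only [one_mul] at e31
  rw [e31, e1] at hplus
  rw [e3m, e2] at hminus
  rw [e4] at hplus hminus
  rw [e5] at hplus hminus
  -- Subtracting the two forms leaves `4 Θ ‖u‖² ≤ 2 Θ (‖u‖² + Θ² ‖g‖²)`.
  have : Θ * (∫ x, u x ^ 2 ∂π) ≤ Θ * (Θ ^ 2 * ∫ x, g x ^ 2 ∂π) := by linarith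
  exact le_of_mul_le_mul_left this hΘ

/-- The operator `P exp(t 1_A)`. -/
def rightTiltOp (K : Kernel X X) (A : Set X) (t : ℝ) (g : X → ℝ) (x : X) : ℝ :=
  ∫ y, tilt A t y * g y ∂K x

lemma bddMeas_rightTiltOp_iterate {A : Set X} (hA : MeasurableSet A) (t : ℝ) (k : ℕ) :
    BddMeas ((rightTiltOp K A t)^[k] (fun _ => 1)) := by
  induction k with
  | zero => exact BddMeas.const 1
  | succ k ih =>
    rw [Function.iterate_succ_apply']
    exact ((bddMeas_tilt hA _).mul ih).integral_kernel K

lemma rightTiltOp_iterate_nonneg (K : Kernel X X) (A : Set X) (t : ℝ) (k : ℕ) (x : X) :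
    0 ≤ (rightTiltOp K A t)^[k] (fun _ => 1) x := by
  induction k generalizing x with
  | zero => exact zero_le_one
  | succ k ih =>
    rw [Function.iterate_succ_apply']
    exact integral_nonneg fun y => mul_nonneg (tilt_pos _ _ _).le (ih y)

/-- Each factor `exp(t 1_A)` between two kernels splits into halves, passing from the path
functional to powers of the symmetric operator. -/
lemma tiltOp_iterate (K : Kernel X X) (A : Set X) (t : ℝ) (k : ℕ) (x : X) :
    (tiltOp K A t)^[k] (tilt A (t / 2)) x =
      tilt A (t / 2) x * (rightTiltOp K A t)^[k] (fun _ => 1) x := by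
  induction k generalizing x with
  | zero => simp
  | succ k ih =>
    rw [Function.iterate_succ_apply', Function.iterate_succ_apply', tiltOp, rightTiltOp]
    congr 2; ext y
    rw [ih, ← mul_assoc, tilt_mul_tilt, add_halves]

/-- This is the first visit, where no kernel acts: Hoeffding's lemma, read off from the two-state
form at `l = 0`. That form has rank one and is tested on the vector that defines it. -/
lemma integral_tilt_le {l : ℝ} (hl0 : 0 ≤ l) (hl1 : l < 1) {A : Set X} (hA : MeasurableSet A)
    (t : ℝ) : ∫ x, tilt A t x ∂π ≤ tiltBound l (π.real A) t := by
  have h1 := integral_tilt_mul (μ := π) hA t (BddMeas.const 1)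
  simp only [mul_one, integral_const, measureReal_restrict_apply_univ, smul_eq_mul] at h1
  have hp0 : 0 ≤ π.real A := measureReal_nonneg
  have hp1 : π.real A ≤ 1 := measureReal_le_one
  rw [h1, probReal_compl_eq_one_sub hA]
  have h2 := two_state_quadratic_le (l := 0) (t := t) (x := Real.exp (t / 2) * √(π.real A))
    (y := √(1 - π.real A)) le_rfl zero_lt_one hp0 hp1
  have e1 : Real.exp (t / 2) ^ 2 = Real.exp t := by rw [← Real.exp_nat_mul]; congr 1; push_cast; ring
  have e2 : √(π.real A) ^ 2 = π.real A := Real.sq_sqrt hp0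
  have e3 : √(1 - π.real A) ^ 2 = 1 - π.real A := Real.sq_sqrt (by linarith)
  have e4 : Real.exp (t / 2) * √(π.real A) * (Real.exp (t / 2) * √(π.real A)) +
      √(1 - π.real A) * √(1 - π.real A) = Real.exp t * π.real A + (1 - π.real A) := by
    rw [← e1, ← sq, ← sq, mul_pow, e2, e3]
  rw [e4, mul_pow, e1, e2, e3] at h2
  set q := Real.exp t * π.real A + (1 - π.real A)
  have hq : 0 < q := by
    rcases eq_or_lt_of_le hp0 with h | h
    · simp [q, ← h]
    · have := mul_pos (Real.exp_pos t) h
      simp only [q]; linarith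
  have h3 : q ≤ Real.exp (t * π.real A + t ^ 2 * ((1 + 0) / (1 - 0)) / 8) := by
    refine le_of_mul_le_mul_right ?_ hq
    linarith
  refine h3.trans (Real.exp_le_exp.2 ?_)
  have h4 : (1 + 0) / (1 - 0) ≤ (1 + l) / (1 - l) := by
    rw [div_le_div_iff₀ (by norm_num) (by linarith)]; linarith
  gcongr

/-- Write the integral as `⟨E, (E P E)^k E⟩`. The two outer vectors contribute `√Θ` each and the
operator `Θ^k`, hence the power `k + 1`. -/
lemma integral_tilt_mul_rightTiltOp_iterate_le (hrev : K.IsReversible π) {l : ℝ}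
    (hl : l = max 0 (specSup K π hrev.invariant)) (hl1 : l < 1) {A : Set X}
    (hA : MeasurableSet A) (t : ℝ) (k : ℕ) :
    ∫ x, tilt A t x * (rightTiltOp K A t)^[k] (fun _ => 1) x ∂π ≤
      tiltBound l (π.real A) t ^ (k + 1) := by
  have hl0 : 0 ≤ l := hl ▸ le_max_left _ _
  set Θ := tiltBound l (π.real A) t
  have hΘ : 0 < Θ := tiltBound_pos _ _ _
  have hE := bddMeas_tilt hA (t / 2)
  have hb : ∀ k, BddMeas ((tiltOp K A t)^[k] (tilt A (t / 2))) := by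
    intro k
    induction k with
    | zero => exact hE
    | succ k ih => rw [Function.iterate_succ_apply']; exact bddMeas_tiltOp hA t ih
  have h1 : ∫ x, tilt A (t / 2) x ^ 2 ∂π ≤ Θ := by
    refine le_trans (le_of_eq ?_) (integral_tilt_le hl0 hl1 hA t)
    congr 1; ext x; rw [sq, tilt_mul_tilt, add_halves]
  have h2 : ∀ k, ∫ x, (tiltOp K A t)^[k] (tilt A (t / 2)) x ^ 2 ∂π ≤ (Θ ^ 2) ^ k * Θ := by
    intro k
    induction k with
    | zero => simpa using h1
    | succ k ih =>
      rw [Function.iterate_succ_apply', pow_succ', mul_assoc]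
      exact (integral_tiltOp_sq_le hrev hl hl1 hA t (hb k)).trans
        (mul_le_mul_of_nonneg_left ih (by positivity))
  have h3 := integral_mul_sq_le (hE.memLp 2 π) ((hb k).memLp 2 π)
  have h4 : ∫ x, tilt A (t / 2) x * (tiltOp K A t)^[k] (tilt A (t / 2)) x ∂π =
      ∫ x, tilt A t x * (rightTiltOp K A t)^[k] (fun _ => 1) x ∂π := by
    congr 1; ext x
    rw [tiltOp_iterate, ← mul_assoc, tilt_mul_tilt, add_halves]
  rw [h4] at h3
  refine (abs_le_of_sq_le_sq' (h3.trans ?_) (by positivity)).2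
  calc _ ≤ Θ * ((Θ ^ 2) ^ k * Θ) := mul_le_mul h1 (h2 k)
        (integral_nonneg fun x => sq_nonneg _) hΘ.le
    _ = _ := by rw [← pow_mul, ← pow_mul]; ring

/-- Jensen's inequality at each step: squaring a path functional doubles `t`. This reduces its
`L₂`-norm to a stationary moment generating function. -/
lemma rightTiltOp_iterate_sq_le {A : Set X} (hA : MeasurableSet A) (t : ℝ) (k : ℕ) (x : X) :
    ((rightTiltOp K A t)^[k] (fun _ => 1) x) ^ 2 ≤
      (rightTiltOp K A (2 * t))^[k] (fun _ => 1) x := by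
  induction k generalizing x with
  | zero => simp
  | succ k ih =>
    rw [Function.iterate_succ_apply', Function.iterate_succ_apply']
    have hb := (bddMeas_tilt hA t).mul (bddMeas_rightTiltOp_iterate (K := K) hA t k)
    have h1 := integral_mul_sq_le (μ := K x) ((BddMeas.const 1).memLp 2 _) (hb.memLp 2 _)
    simp only [one_mul, one_pow, integral_const, probReal_univ, smul_eq_mul] at h1
    refine h1.trans (integral_mono (hb.sq.integrable _)
      (((bddMeas_tilt hA (2 * t)).mul (bddMeas_rightTiltOp_iterate hA (2 * t) k)).integrable _)
      fun y => ?_)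
    dsimp only
    rw [mul_pow, sq (tilt _ _ _), tilt_mul_tilt, ← two_mul]
    exact mul_le_mul_of_nonneg_left (ih y) (tilt_pos _ _ _).le

/-- The `L₂`-norm of the conditional moment generating function of the occupation time of `A`. -/
lemma integral_sq_tilt_mul_rightTiltOp_iterate_le (hrev : K.IsReversible π) {l : ℝ}
    (hl : l = max 0 (specSup K π hrev.invariant)) (hl1 : l < 1) {A : Set X}
    (hA : MeasurableSet A) (t : ℝ) (k : ℕ) :
    ∫ x, (tilt A t x * (rightTiltOp K A t)^[k] (fun _ => 1) x) ^ 2 ∂π ≤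
      Real.exp ((k + 1) * (t * π.real A + t ^ 2 * ((1 + l) / (1 - l)) / 4)) ^ 2 := by
  have hb := (bddMeas_tilt hA t).mul (bddMeas_rightTiltOp_iterate (K := K) hA t k)
  have hb2 := (bddMeas_tilt hA (2 * t)).mul (bddMeas_rightTiltOp_iterate (K := K) hA (2 * t) k)
  calc _ ≤ ∫ x, tilt A (2 * t) x * (rightTiltOp K A (2 * t))^[k] (fun _ => 1) x ∂π := by
        refine integral_mono (hb.sq.integrable _) (hb2.integrable _) fun y => ?_
        dsimp only
        rw [mul_pow, sq (tilt _ _ _), tilt_mul_tilt, ← two_mul]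
        exact mul_le_mul_of_nonneg_left (rightTiltOp_iterate_sq_le hA t k y) (tilt_pos _ _ _).le
    _ ≤ _ := integral_tilt_mul_rightTiltOp_iterate_le hrev hl hl1 hA (2 * t) k
    _ = _ := by
        rw [tiltBound, ← Real.exp_nat_mul, ← Real.exp_nat_mul]
        congr 1; push_cast; ring

end Tilted

/-! ### Densities of `νP^k`, their norms and the bias. -/

section Densities

open scoped InnerProductSpace

variable {X : Type*} [MeasurableSpace X] {K : Kernel X X} [IsMarkovKernel K]
  {π ν : Measure X} [IsProbabilityMeasure π]

/-- Swapping the two coordinates of the symmetric measure `π ⊗ₘ K` moves `ρ` from the departure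
point to the arrival point, so densities evolve by the Markov operator itself. -/
lemma bind_withDensity (hrev : K.IsReversible π) {ρ : X → ℝ≥0∞} (hρ : Measurable ρ) :
    (π.withDensity ρ).bind K = π.withDensity (fun x => ∫⁻ y, ρ y ∂K x) := by
  ext A hA
  rw [Measure.bind_apply hA K.aemeasurable, withDensity_apply _ hA,
    lintegral_withDensity_eq_lintegral_mul _ hρ (K.measurable_coe hA)]
  have h1 : Measurable (A.indicator (fun _ => (1 : ℝ≥0∞))) := measurable_const.indicator hA
  have hF : Measurable fun p : X × X => ρ p.1 * A.indicator (fun _ => (1 : ℝ≥0∞)) p.2 :=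
    (hρ.comp measurable_fst).mul (h1.comp measurable_snd)
  calc ∫⁻ x, (ρ * fun x => K x A) x ∂π
      = ∫⁻ x, ∫⁻ y, ρ x * A.indicator (fun _ => (1 : ℝ≥0∞)) y ∂K x ∂π := by
        refine lintegral_congr fun x => ?_
        rw [lintegral_const_mul _ h1, lintegral_indicator_const hA, one_mul]; rfl
    _ = ∫⁻ p, ρ p.1 * A.indicator (fun _ => (1 : ℝ≥0∞)) p.2 ∂(π ⊗ₘ K) :=
        (Measure.lintegral_compProd hF).symm
    _ = ∫⁻ p, ρ p.2 * A.indicator (fun _ => (1 : ℝ≥0∞)) p.1 ∂(π ⊗ₘ K) := by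
        conv_lhs => rw [← map_swap_compProd hrev, lintegral_map hF measurable_swap]
        rfl
    _ = ∫⁻ x, ∫⁻ y, ρ y * A.indicator (fun _ => (1 : ℝ≥0∞)) x ∂K x ∂π :=
        Measure.lintegral_compProd ((hρ.comp measurable_snd).mul (h1.comp measurable_fst))
    _ = ∫⁻ x, A.indicator (fun x => ∫⁻ y, ρ y ∂K x) x ∂π := by
        refine lintegral_congr fun x => ?_
        rw [lintegral_mul_const _ hρ]
        by_cases hx : x ∈ A <;> simp [hx]
    _ = _ := lintegral_indicator hA _

/-- `f` is the density of `μ` with respect to `π`. -/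
structure IsL2DensityOf (f : Lp ℝ 2 π) (μ : Measure X) : Prop where
  nonneg : ∀ᵐ x ∂π, 0 ≤ f x
  eq_withDensity : μ = π.withDensity (fun x => ENNReal.ofReal (f x))

namespace IsL2DensityOf

variable {f : Lp ℝ 2 π} {μ : Measure X}

lemma rnDeriv_toReal (h : IsL2DensityOf f μ) :
    (fun x => (μ.rnDeriv π x).toReal) =ᵐ[π] f := by
  have h1 := Measure.rnDeriv_withDensity π (Lp.stronglyMeasurable f).measurable.ennreal_ofReal
  rw [← h.eq_withDensity] at h1
  filter_upwards [h1, h.nonneg] with x hx hx0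
  rw [hx, ENNReal.toReal_ofReal hx0]

lemma hasL2Density (h : IsL2DensityOf f μ) : HasL2Density μ π :=
  ⟨h.eq_withDensity ▸ withDensity_absolutelyContinuous _ _,
    (memLp_congr_ae h.rnDeriv_toReal).2 (Lp.memLp f)⟩

lemma densityNorm_eq (h : IsL2DensityOf f μ) : densityNorm μ π = ‖f‖ := by
  rw [densityNorm, eLpNorm_congr_ae h.rnDeriv_toReal, Lp.norm_def]

lemma densitySubOneNorm_eq (h : IsL2DensityOf f μ) :
    densitySubOneNorm μ π = ‖f - oneL2 π‖ := by
  rw [densitySubOneNorm, Lp.norm_def]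
  congr 1
  refine eLpNorm_congr_ae ?_
  filter_upwards [h.rnDeriv_toReal, Lp.coeFn_sub f (oneL2 π), coeFn_oneL2 (π := π)]
    with x h1 h2 h3
  rw [h1, h2, Pi.sub_apply, h3]

lemma lintegral_ofReal (h : IsL2DensityOf f μ) {g : X → ℝ} (hg : BddMeas g) (hg0 : ∀ x, 0 ≤ g x) :
    ∫⁻ x, ENNReal.ofReal (g x) ∂μ = ENNReal.ofReal (∫ x, f x * g x ∂π) := by
  have hint : Integrable (fun x => f x * g x) π := (Lp.memLp f).integrable_mul (hg.memLp 2 π)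
  have h0 : 0 ≤ᵐ[π] fun x => f x * g x := by
    filter_upwards [h.nonneg] with x hx using mul_nonneg hx (hg0 x)
  rw [h.eq_withDensity, lintegral_withDensity_eq_lintegral_mul _
    (Lp.stronglyMeasurable f).measurable.ennreal_ofReal hg.1.ennreal_ofReal,
    ofReal_integral_eq_lintegral_ofReal hint h0]
  refine lintegral_congr_ae ?_
  filter_upwards [h.nonneg] with x hx
  rw [Pi.mul_apply, ENNReal.ofReal_mul hx]

lemma measureReal_eq (h : IsL2DensityOf f μ) {A : Set X} (hA : MeasurableSet A) :
    μ.real A = ⟪indicatorConstLp 2 hA (measure_ne_top π A) (1 : ℝ), f⟫_ℝ := by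
  have h1 := h.lintegral_ofReal (g := A.indicator fun _ => (1 : ℝ))
    ⟨measurable_const.indicator hA, 1, fun x => by by_cases hx : x ∈ A <;> simp [hx]⟩
    (fun x => Set.indicator_nonneg (fun _ _ => zero_le_one) x)
  have h2 : ∀ x, ENNReal.ofReal (A.indicator (fun _ => (1 : ℝ)) x) =
      A.indicator (fun _ => (1 : ℝ≥0∞)) x := fun x => by by_cases hx : x ∈ A <;> simp [hx]
  simp only [h2] at h1
  rw [lintegral_indicator_const hA, one_mul] at h1
  rw [Measure.real, h1, ENNReal.toReal_ofReal, L2.inner_indicatorConstLp_one,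
    ← integral_indicator hA]
  · congr 1; ext x
    by_cases hx : x ∈ A <;> simp [hx]
  · refine integral_nonneg_of_ae ?_
    filter_upwards [h.nonneg] with x hx
    exact mul_nonneg hx (Set.indicator_nonneg (fun _ _ => zero_le_one) x)

lemma inner_one [IsProbabilityMeasure μ] (h : IsL2DensityOf f μ) : ⟪oneL2 π, f⟫_ℝ = 1 := by
  have h1 := h.measureReal_eq MeasurableSet.univ
  rw [probReal_univ, L2.inner_indicatorConstLp_one, setIntegral_univ] at h1
  rw [inner_oneL2, h1]

/-- Cauchy-Schwarz against the constant `1`. It makes the logarithms in the final bounds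
nonnegative. -/
lemma one_le_norm [IsProbabilityMeasure μ] (h : IsL2DensityOf f μ) : 1 ≤ ‖f‖ := by
  have h1 := real_inner_le_norm (oneL2 π) f
  rwa [h.inner_one, norm_oneL2, one_mul] at h1

lemma sub_one_mem [IsProbabilityMeasure μ] (h : IsL2DensityOf f μ) : f - oneL2 π ∈ L20 π := by
  rw [mem_L20_iff, inner_sub_right, h.inner_one, real_inner_self_eq_norm_sq, norm_oneL2_sq,
    sub_self]

lemma bind (hrev : K.IsReversible π) (h : IsL2DensityOf f μ) :
    IsL2DensityOf (markovOp K π hrev.invariant f) (μ.bind K) := by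
  have h0 : ∀ᵐ y ∂(π.bind K), 0 ≤ f y := by rw [hrev.invariant.def]; exact h.nonneg
  have h0' := Measure.ae_ae_of_ae_comp h0
  refine ⟨?_, ?_⟩
  · filter_upwards [markovOp_coeFn K π hrev.invariant f, h0'] with x hx hx0
    rw [hx]
    exact integral_nonneg_of_ae hx0
  · rw [h.eq_withDensity, bind_withDensity hrev
      (Lp.stronglyMeasurable f).measurable.ennreal_ofReal]
    refine withDensity_congr_ae ?_
    filter_upwards [markovOp_coeFn K π hrev.invariant f, h0',
      ae_integrable_kernel hrev.invariant f] with x hx hx0 hxi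
    rw [hx, ofReal_integral_eq_lintegral_ofReal hxi hx0]

lemma iterMeasure (hrev : K.IsReversible π) (h : IsL2DensityOf f μ) (k : ℕ) :
    IsL2DensityOf ((markovOp K π hrev.invariant ^ k) f) (iterMeasure K μ k) := by
  induction k with
  | zero => exact h
  | succ k ih =>
    rw [pow_succ', mul_apply_eq_comp, MCQMC.iterMeasure, Function.iterate_succ_apply']
    exact ih.bind hrev

end IsL2DensityOf

lemma HasL2Density.isL2DensityOf [IsProbabilityMeasure ν] (h : HasL2Density ν π) :
    IsL2DensityOf (h.2.toLp _) ν := by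
  have h1 := h.2.coeFn_toLp
  refine ⟨?_, ?_⟩
  · filter_upwards [h1] with x hx
    rw [hx]; exact ENNReal.toReal_nonneg
  · refine (Measure.withDensity_rnDeriv_eq ν π h.1).symm.trans (withDensity_congr_ae ?_)
    filter_upwards [h1, Measure.rnDeriv_lt_top ν π] with x hx hx'
    rw [hx, ENNReal.ofReal_toReal hx'.ne]

instance isProbabilityMeasure_iterMeasure [IsProbabilityMeasure ν] (k : ℕ) :
    IsProbabilityMeasure (iterMeasure K ν k) := by
  induction k with
  | zero => assumption
  | succ k ih =>
    rw [MCQMC.iterMeasure, Function.iterate_succ_apply']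
    have : IsProbabilityMeasure ((fun μ : Measure X => μ.bind K)^[k] ν) := ih
    infer_instance

/-- `νP^k - 1` as an element of `L₂⁰`. -/
lemma markovOp_pow_sub_one (hK : K.Invariant π) (f : Lp ℝ 2 π) (g : L20 π)
    (hg : (g : Lp ℝ 2 π) = f - oneL2 π) (k : ℕ) :
    (markovOp K π hK ^ k) f = oneL2 π + ((markovOp0 K π hK ^ k) g : L20 π) := by
  have h1 : (markovOp K π hK ^ k) (oneL2 π) = oneL2 π := by
    induction k with
    | zero => rfl
    | succ k ih => rw [pow_succ', mul_apply_eq_comp, ih, markovOp_oneL2]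
  rw [coe_markovOp0_pow_apply, hg, map_sub, h1]
  abel

/-- The density of `νP^k` is `1 + P^k (dν/dπ - 1)`, and the second term stays in `L₂⁰`, where `P`
has norm `β`. -/
lemma densityNorm_iterMeasure_le (hrev : K.IsReversible π) [IsProbabilityMeasure ν]
    (hν : HasL2Density ν π) (k : ℕ) :
    densityNorm (iterMeasure K ν k) π ≤
      1 + opNorm0 K π hrev.invariant ^ k * densitySubOneNorm ν π := by
  have h := hν.isL2DensityOf
  rw [(h.iterMeasure hrev k).densityNorm_eq, h.densitySubOneNorm_eq,
    markovOp_pow_sub_one hrev.invariant _ ⟨_, h.sub_one_mem⟩ rfl k]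
  exact (norm_add_le _ _).trans (add_le_add norm_oneL2.le
    (norm_markovOp0_pow_apply_le hrev.invariant k ⟨_, h.sub_one_mem⟩))

/-- The bias of the burn-in averages. -/
lemma abs_sum_iterMeasure_sub_le (hrev : K.IsReversible π) [IsProbabilityMeasure ν]
    (hν : HasL2Density ν π) {l : ℝ} (hl : l = max 0 (specSup K π hrev.invariant))
    {A : Set X} (hA : MeasurableSet A) (n₀ n : ℕ) :
    |∑ j ∈ Finset.range n, ((iterMeasure K ν (n₀ + j)).real A - π.real A)| ≤
      (∑ j ∈ Finset.range n, l ^ j) * (opNorm0 K π hrev.invariant ^ n₀ * densitySubOneNorm ν π) := by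
  have h := hν.isL2DensityOf
  set g : L20 π := ⟨_, h.sub_one_mem⟩ with hg
  set P := markovOp0 K π hrev.invariant
  set e := indicatorConstLp 2 hA (measure_ne_top π A) (1 : ℝ)
  have he : ⟪e, oneL2 π⟫_ℝ = π.real A := by
    rw [real_inner_comm, inner_oneL2]
    simp only [e]
    rw [integral_indicatorConstLp]; simp
  have hne : ‖e‖ ≤ 1 := by
    have h1 := real_inner_self_eq_norm_sq e
    have h2 : ⟪e, e⟫_ℝ = π.real A := by
      conv_lhs => rw [L2.inner_indicatorConstLp_one]
      rw [setIntegral_congr_ae hA ((indicatorConstLp_coeFn (p := 2) (hs := hA)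
        (hμs := measure_ne_top π A) (c := (1 : ℝ))).mono fun x hx _ => hx),
        setIntegral_indicator hA]
      simp
    have h3 : ‖e‖ ^ 2 ≤ 1 := by rw [← h1, h2]; exact measureReal_le_one
    exact (sq_le_one_iff₀ (norm_nonneg _)).1 h3
  -- Summing over `j` before taking norms keeps the geometric sum of `P` intact, so its rate is `Λ₀`
  -- rather than `β`; only the common factor `P^n₀` costs powers of `β`.
  have hsum : ∑ j ∈ Finset.range n, ((iterMeasure K ν (n₀ + j)).real A - π.real A) =
      ⟪e, ((∑ j ∈ Finset.range n, (P ^ j) ((P ^ n₀) g) : L20 π) : Lp ℝ 2 π)⟫_ℝ := by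
    rw [Submodule.coe_sum, inner_sum]
    refine Finset.sum_congr rfl fun j _ => ?_
    rw [(h.iterMeasure hrev (n₀ + j)).measureReal_eq hA,
      markovOp_pow_sub_one hrev.invariant _ g rfl, inner_add_right, he, add_comm n₀ j, pow_add,
      mul_apply_eq_comp]
    ring
  rw [hsum, h.densitySubOneNorm_eq]
  have hs : 0 ≤ ∑ j ∈ Finset.range n, l ^ j :=
    Finset.sum_nonneg fun j _ => pow_nonneg (hl ▸ le_max_left _ _) j
  calc _ ≤ ‖e‖ * ‖((∑ j ∈ Finset.range n, (P ^ j) ((P ^ n₀) g) : L20 π) : Lp ℝ 2 π)‖ :=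
        abs_real_inner_le_norm _ _
    _ ≤ 1 * ((∑ j ∈ Finset.range n, l ^ j) * ‖(P ^ n₀) g‖) := by
        refine mul_le_mul hne ?_ (norm_nonneg _) zero_le_one
        rw [hl]
        exact norm_sum_markovOp0_pow_le hrev n ((P ^ n₀) g)
    _ ≤ _ := by
        rw [one_mul]
        exact mul_le_mul_of_nonneg_left (norm_markovOp0_pow_apply_le hrev.invariant n₀ g) hs

end Densities

/-! ### The chain generated by uniform driver points. -/

section Chain

variable {X : Type*} {s : ℕ} {φ : X → Cube s → X} {ψ : Cube s → X}

lemma burnInPoints_last (n₀ n : ℕ) (u : Fin (n₀ + (n + 1)) → Cube s) :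
    burnInPoints φ ψ n₀ (n + 1) u (Fin.last n) = chainState φ ψ (n₀ + n) u := rfl

variable [MeasurableSpace X] {K : Kernel X X} {ν : Measure X}

/-- Fubini with the last driver point split off. `piFinSuccAbove` lists the removed coordinate
first, hence the swap. -/
lemma lintegral_init_last {N : ℕ} {H : (Fin N → Cube s) × Cube s → ℝ≥0∞} (hH : Measurable H) :
    ∫⁻ u : Fin (N + 1) → Cube s, H (Fin.init u, u (Fin.last N)) =
      ∫⁻ v : Fin N → Cube s, ∫⁻ w : Cube s, H (v, w) := by
  have hmp := volume_preserving_piFinSuccAbove (fun _ : Fin (N + 1) => Cube s) (Fin.last N)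
  have h1 : ∀ u : Fin (N + 1) → Cube s, H (Fin.init u, u (Fin.last N)) =
      (H ∘ Prod.swap) (MeasurableEquiv.piFinSuccAbove (fun _ => Cube s) (Fin.last N) u) := by
    intro u
    simp only [Function.comp_apply, MeasurableEquiv.piFinSuccAbove_apply]
    congr 2
    ext j : 1
    simp [Fin.init, Fin.insertNthEquiv]
  simp only [h1]
  rw [hmp.lintegral_comp (hH.comp measurable_swap), Measure.volume_eq_prod,
    lintegral_prod_symm _ (hH.comp measurable_swap).aemeasurable]
  rfl

lemma measurable_chainState (hφ : Measurable fun p : X × Cube s => φ p.1 p.2)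
    (hψ : Measurable ψ) (i : ℕ) : Measurable (chainState φ ψ i) := by
  induction i with
  | zero => exact hψ.comp (measurable_pi_apply 0)
  | succ i ih =>
    have h1 : Measurable fun u : Fin (i + 2) → Cube s => Fin.init (n := i + 1) u :=
      measurable_pi_lambda _ fun j => measurable_pi_apply _
    exact hφ.comp ((ih.comp h1).prodMk (measurable_pi_apply (Fin.last (i + 1))))

lemma IsUpdateFunction.lintegral_eq (hφ : IsUpdateFunction φ K) (x : X) {g : X → ℝ≥0∞}
    (hg : Measurable g) : ∫⁻ w, g (φ x w) = ∫⁻ y, g y ∂K x := by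
  have hm : Measurable (φ x) := hφ.1.comp measurable_prodMk_left
  have h1 : K x = (volume : Measure (Cube s)).map (φ x) := by
    ext A hA
    rw [Measure.map_apply hm hA, hφ.2 x A hA]; rfl
  rw [h1, lintegral_map hg hm]

lemma IsGeneratorFunction.lintegral_eq (hψ : IsGeneratorFunction ψ ν) {g : X → ℝ≥0∞}
    (hg : Measurable g) : ∫⁻ w, g (ψ w) = ∫⁻ y, g y ∂ν := by
  have h1 : ν = (volume : Measure (Cube s)).map ψ := by
    ext A hA
    rw [Measure.map_apply hψ.1 hA, hψ.2 A hA]; rfl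
  rw [h1, lintegral_map hg hψ.1]

/-- The law of `x_{M+1}` is `ν P^M`. -/
lemma lintegral_chainState (hφ : IsUpdateFunction φ K) (hψ : IsGeneratorFunction ψ ν) (M : ℕ)
    {g : X → ℝ≥0∞} (hg : Measurable g) :
    ∫⁻ u : Fin (M + 1) → Cube s, g (chainState φ ψ M u) = ∫⁻ x, g x ∂iterMeasure K ν M := by
  induction M generalizing g with
  | zero =>
    have h := lintegral_init_last (N := 0) (H := fun p : (Fin 0 → Cube s) × Cube s => g (ψ p.2))
      (hg.comp (hψ.1.comp measurable_snd))
    simp only [lintegral_const, measure_univ, mul_one, hψ.lintegral_eq hg] at h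
    exact h
  | succ M ih =>
    have h := lintegral_init_last (N := M + 1)
      (H := fun p : (Fin (M + 1) → Cube s) × Cube s => g (φ (chainState φ ψ M p.1) p.2))
      (hg.comp (hφ.1.comp (((measurable_chainState hφ.1 hψ.1 M).comp measurable_fst).prodMk
        measurable_snd)))
    simp only [hφ.lintegral_eq _ hg] at h
    rw [ih hg.lintegral_kernel] at h
    rw [iterMeasure, Function.iterate_succ_apply',
      Measure.lintegral_bind K.aemeasurable hg.aemeasurable]
    exact h

lemma volume_pullBack (hφ : IsUpdateFunction φ K) (hψ : IsGeneratorFunction ψ ν) (M : ℕ)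
    {A : Set X} (hA : MeasurableSet A) :
    volume (pullBack φ ψ M A) = iterMeasure K ν M A := by
  have h := lintegral_chainState hφ hψ M
    (g := A.indicator fun _ => 1) (measurable_const.indicator hA)
  rw [lintegral_indicator_const hA, one_mul] at h
  rw [← h]
  exact (lintegral_indicator_one (measurable_chainState hφ.1 hψ.1 M hA)).symm

lemma measurable_burnInPoints (hφ : Measurable fun p : X × Cube s => φ p.1 p.2)
    (hψ : Measurable ψ) (n₀ n : ℕ) (j : Fin n) :
    Measurable fun u => burnInPoints φ ψ n₀ n u j :=
  (measurable_chainState hφ hψ _).comp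
    (measurable_pi_lambda _ fun _ => measurable_pi_apply _)

/-- The Markov property: multiplicative functionals of the path as iterated operators. -/
lemma lintegral_prod_burnInPoints (hφ : IsUpdateFunction φ K) (hψ : IsGeneratorFunction ψ ν)
    {F : X → ℝ≥0∞} (hF : Measurable F) (n₀ n : ℕ) {g : X → ℝ≥0∞} (hg : Measurable g) :
    ∫⁻ u : Fin (n₀ + (n + 1)) → Cube s, (∏ j, F (burnInPoints φ ψ n₀ (n + 1) u j)) *
        g (burnInPoints φ ψ n₀ (n + 1) u (Fin.last n)) =
      ∫⁻ x, F x * (fun (h : X → ℝ≥0∞) x => ∫⁻ y, F y * h y ∂K x)^[n] g x ∂iterMeasure K ν n₀ := by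
  -- Integrating out the last driver point replaces the terminal function `g` by `P (F g)`, so the
  -- induction must allow arbitrary `g`.
  induction n generalizing g with
  | zero =>
    simp only [Fin.prod_univ_castSucc, Finset.univ_eq_empty, Finset.prod_empty, one_mul,
      Function.iterate_zero, id_eq]
    exact lintegral_chainState hφ hψ n₀ (hF.mul hg)
  | succ n ih =>
    have hlast : Measurable (chainState φ ψ (n₀ + n)) := measurable_chainState hφ.1 hψ.1 _
    have hprod : Measurable fun v : Fin (n₀ + (n + 1)) → Cube s =>
        ∏ j, F (burnInPoints φ ψ n₀ (n + 1) v j) :=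
      Finset.measurable_prod _ fun j _ => hF.comp (measurable_burnInPoints hφ.1 hψ.1 n₀ (n + 1) j)
    have hstep : Measurable fun p : (Fin (n₀ + (n + 1)) → Cube s) × Cube s =>
        φ (chainState φ ψ (n₀ + n) p.1) p.2 :=
      hφ.1.comp ((hlast.comp measurable_fst).prodMk measurable_snd)
    have h := lintegral_init_last (N := n₀ + (n + 1))
      (H := fun p : (Fin (n₀ + (n + 1)) → Cube s) × Cube s =>
        (∏ j, F (burnInPoints φ ψ n₀ (n + 1) p.1 j)) *
          (F (φ (chainState φ ψ (n₀ + n) p.1) p.2) * g (φ (chainState φ ψ (n₀ + n) p.1) p.2)))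
      ((hprod.comp measurable_fst).mul ((hF.comp hstep).mul (hg.comp hstep)))
    have hin : ∀ v : Fin (n₀ + (n + 1)) → Cube s, ∫⁻ w : Cube s,
        (∏ j, F (burnInPoints φ ψ n₀ (n + 1) v j)) *
          (F (φ (chainState φ ψ (n₀ + n) v) w) * g (φ (chainState φ ψ (n₀ + n) v) w)) =
        (∏ j, F (burnInPoints φ ψ n₀ (n + 1) v j)) *
          ∫⁻ y, F y * g y ∂K (burnInPoints φ ψ n₀ (n + 1) v (Fin.last n)) := by
      intro v
      have hv : Measurable fun w => φ (chainState φ ψ (n₀ + n) v) w :=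
        hφ.1.comp measurable_prodMk_left
      have hv' : Measurable fun w => F (φ (chainState φ ψ (n₀ + n) v) w) *
          g (φ (chainState φ ψ (n₀ + n) v) w) := (hF.comp hv).mul (hg.comp hv)
      rw [lintegral_const_mul _ hv', burnInPoints_last,
        ← hφ.lintegral_eq _ (g := fun y => F y * g y) (hF.mul hg)]
    simp only [hin] at h
    rw [ih (g := fun x => ∫⁻ y, F y * g y ∂K x) (hF.mul hg).lintegral_kernel] at h
    rw [Function.iterate_succ_apply, ← h]
    refine lintegral_congr fun u => ?_
    rw [Fin.prod_univ_castSucc, mul_assoc]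
    rfl

lemma lintegral_prod_tilt_burnInPoints [IsMarkovKernel K] (hφ : IsUpdateFunction φ K)
    (hψ : IsGeneratorFunction ψ ν) {A : Set X} (hA : MeasurableSet A) (t : ℝ) (n₀ n : ℕ) :
    ∫⁻ u : Fin (n₀ + (n + 1)) → Cube s,
        ∏ j, ENNReal.ofReal (tilt A t (burnInPoints φ ψ n₀ (n + 1) u j)) =
      ∫⁻ x, ENNReal.ofReal (tilt A t x * (rightTiltOp K A t)^[n] (fun _ => 1) x)
        ∂iterMeasure K ν n₀ := by
  have h := lintegral_prod_burnInPoints hφ hψ (measurable_tilt hA t).ennreal_ofReal n₀ n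
    (g := fun _ => 1) measurable_const
  simp only [mul_one] at h
  rw [h]
  have h1 : ∀ n x, (fun (h : X → ℝ≥0∞) x => ∫⁻ y, ENNReal.ofReal (tilt A t y) * h y ∂K x)^[n]
      (fun _ => 1) x = ENNReal.ofReal ((rightTiltOp K A t)^[n] (fun _ => 1) x) := by
    intro n
    induction n with
    | zero => intro x; simp
    | succ n ih =>
      intro x
      rw [Function.iterate_succ_apply', Function.iterate_succ_apply', rightTiltOp,
        ofReal_integral_eq_lintegral_ofReal]
      · refine lintegral_congr fun y => ?_
        rw [ih, ENNReal.ofReal_mul (tilt_pos _ _ _).le]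
      · exact ((bddMeas_tilt hA t).mul (bddMeas_rightTiltOp_iterate hA t n)).integrable _
      · exact ae_of_all _ fun y => mul_nonneg (tilt_pos _ _ _).le
          (rightTiltOp_iterate_nonneg K A t n y)
  refine lintegral_congr fun x => ?_
  rw [h1, ENNReal.ofReal_mul (tilt_pos _ _ _).le]

end Chain

/-! ### Exponential tail bounds for occupation times. -/

section Tail

variable {X : Type*} [MeasurableSpace X] {s : ℕ} {K : Kernel X X} [IsMarkovKernel K]
  {π ν : Measure X} [IsProbabilityMeasure π] [IsProbabilityMeasure ν]
  {φ : X → Cube s → X} {ψ : Cube s → X}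

/-- The Chernoff bound for the occupation time of `A` after a burn-in. -/
lemma volume_le_mul_sum_le (hrev : K.IsReversible π) (hν : HasL2Density ν π) {l : ℝ}
    (hl : l = max 0 (specSup K π hrev.invariant)) (hl1 : l < 1) (hφ : IsUpdateFunction φ K)
    (hψ : IsGeneratorFunction ψ ν) {A : Set X} (hA : MeasurableSet A) (t c : ℝ) (n₀ : ℕ) {n : ℕ}
    (hn : 1 ≤ n) :
    volume {u : Fin (n₀ + n) → Cube s |
        c ≤ t * ∑ j, A.indicator (fun _ => (1 : ℝ)) (burnInPoints φ ψ n₀ n u j)} ≤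
      ENNReal.ofReal (densityNorm (iterMeasure K ν n₀) π *
        Real.exp (n * (t * π.real A + t ^ 2 * ((1 + l) / (1 - l)) / 4) - c)) := by
  obtain ⟨k, rfl⟩ : ∃ k, n = k + 1 := ⟨n - 1, by omega⟩
  have hf := hν.isL2DensityOf.iterMeasure hrev n₀
  set f := (markovOp K π hrev.invariant ^ n₀) (hν.2.toLp _)
  set v : X → ℝ := fun x => tilt A t x * (rightTiltOp K A t)^[k] (fun _ => 1) x
  have hv : BddMeas v := (bddMeas_tilt hA t).mul (bddMeas_rightTiltOp_iterate hA t k)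
  have hv0 : ∀ x, 0 ≤ v x := fun x =>
    mul_nonneg (tilt_pos _ _ _).le (rightTiltOp_iterate_nonneg K A t k x)
  set Y : (Fin (n₀ + (k + 1)) → Cube s) → ℝ≥0∞ := fun u =>
    ∏ j, ENNReal.ofReal (tilt A t (burnInPoints φ ψ n₀ (k + 1) u j)) with hY
  have hYexp : ∀ u, Y u = ENNReal.ofReal (Real.exp
      (t * ∑ j, A.indicator (fun _ => (1 : ℝ)) (burnInPoints φ ψ n₀ (k + 1) u j))) := fun u => by
    rw [Finset.mul_sum, Real.exp_sum, ENNReal.ofReal_prod_of_nonneg fun j _ => (Real.exp_pos _).le]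
    rfl
  have hYm : Measurable Y := Finset.measurable_prod _ fun j _ =>
    ((measurable_tilt hA t).comp (measurable_burnInPoints hφ.1 hψ.1 n₀ (k + 1) j)).ennreal_ofReal
  set b := Real.exp ((k + 1) * (t * π.real A + t ^ 2 * ((1 + l) / (1 - l)) / 4)) with hb
  -- Cauchy-Schwarz in `L₂(π)` separates the density after burn-in from the path functional.
  have h1 : ∫⁻ u, Y u ≤ ENNReal.ofReal (‖f‖ * b) := by
    rw [hY, lintegral_prod_tilt_burnInPoints hφ hψ hA t n₀ k, hf.lintegral_ofReal hv hv0]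
    refine ENNReal.ofReal_le_ofReal ?_
    have h2 := integral_mul_sq_le (Lp.memLp f) (hv.memLp 2 π)
    have h3 : ∫ x, f x ^ 2 ∂π = ‖f‖ ^ 2 := by
      rw [← real_inner_self_eq_norm_sq, L2.inner_def]
      congr 1; ext x
      rw [real_inner_self_eq_norm_sq, Real.norm_eq_abs, sq_abs]
    rw [h3] at h2
    refine (abs_le_of_sq_le_sq' (h2.trans ?_) (by positivity)).2
    rw [mul_pow]
    exact mul_le_mul_of_nonneg_left
      (integral_sq_tilt_mul_rightTiltOp_iterate_le hrev hl hl1 hA t k) (sq_nonneg _)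
  have h2 := mul_meas_ge_le_lintegral (μ := volume) hYm (ENNReal.ofReal (Real.exp c))
  have h3 : {u : Fin (n₀ + (k + 1)) → Cube s |
        c ≤ t * ∑ j, A.indicator (fun _ => (1 : ℝ)) (burnInPoints φ ψ n₀ (k + 1) u j)} ⊆
      {u | ENNReal.ofReal (Real.exp c) ≤ Y u} := by
    intro u hu
    rw [Set.mem_ofPred_eq, hYexp]
    exact ENNReal.ofReal_le_ofReal (Real.exp_le_exp.2 hu)
  have hc0 : ENNReal.ofReal (Real.exp c) ≠ 0 := by
    rw [ne_eq, ENNReal.ofReal_eq_zero, not_le]; exact Real.exp_pos c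
  refine (measure_mono h3).trans ?_
  refine (ENNReal.mul_le_mul_iff_right hc0 ENNReal.ofReal_ne_top).1 ((h2.trans h1).trans_eq ?_)
  rw [← ENNReal.ofReal_mul (Real.exp_pos c).le, hf.densityNorm_eq, hb, Real.exp_sub]
  congr 1
  push_cast
  field_simp

/-- Hoeffding's inequality for reversible Markov chains with a spectral gap. -/
lemma volume_deviation_le (hrev : K.IsReversible π) (hν : HasL2Density ν π) {l : ℝ}
    (hl : l = max 0 (specSup K π hrev.invariant)) (hl1 : l < 1) (hφ : IsUpdateFunction φ K)
    (hψ : IsGeneratorFunction ψ ν) {A : Set X} (hA : MeasurableSet A) {ε : ℝ} (hε : 0 ≤ ε) (n₀ : ℕ) {n : ℕ}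
    (hn : 1 ≤ n) :
    volume {u : Fin (n₀ + n) → Cube s | ε <
        |(1 / (n : ℝ)) * ∑ j, A.indicator (fun _ => (1 : ℝ)) (burnInPoints φ ψ n₀ n u j) -
          π.real A|} ≤
      2 * ENNReal.ofReal (densityNorm (iterMeasure K ν n₀) π *
        Real.exp (-(n * ε ^ 2 / ((1 + l) / (1 - l))))) := by
  have hl0 : 0 ≤ l := hl ▸ le_max_left _ _
  have hn0 : (0 : ℝ) < n := by exact_mod_cast hn
  have h1l : 0 < 1 - l := by linarith
  set R := (1 + l) / (1 - l) with hRdef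
  have hR : 0 < R := by positivity
  set p := π.real A
  -- This minimizes the Chernoff exponent `n (t² R / 4 - t ε)`; the lower tail uses `-t`.
  set t := 2 * ε / R with ht
  have ht0 : 0 ≤ t := by positivity
  have hplus := volume_le_mul_sum_le hrev hν hl hl1 hφ hψ hA t (t * (n * p + n * ε)) n₀ hn
  have hminus := volume_le_mul_sum_le hrev hν hl hl1 hφ hψ hA (-t) (-t * (n * p - n * ε)) n₀ hn
  have e1 : n * (t * p + t ^ 2 * R / 4) - t * (n * p + n * ε) = -(n * ε ^ 2 / R) := by
    rw [ht]; field_simp; ring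
  have e2 : n * (-t * p + (-t) ^ 2 * R / 4) - -t * (n * p - n * ε) = -(n * ε ^ 2 / R) := by
    rw [ht]; field_simp; ring
  rw [e1] at hplus
  rw [e2] at hminus
  rw [two_mul]
  refine le_trans (measure_mono ?_) ((measure_union_le _ _).trans (add_le_add hplus hminus))
  intro u hu
  rw [Set.mem_ofPred_eq] at hu
  set S := ∑ j, A.indicator (fun _ => (1 : ℝ)) (burnInPoints φ ψ n₀ n u j) with hS
  have hnS : (n : ℝ) * (1 / n * S - p) = S - n * p := by field_simp
  rcases lt_abs.1 hu with h | h
  · left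
    have := mul_le_mul_of_nonneg_left h.le hn0.le
    exact mul_le_mul_of_nonneg_left (by linarith) ht0
  · right
    have := mul_le_mul_of_nonneg_left h.le hn0.le
    have h3 : t * S ≤ t * (n * p - n * ε) := mul_le_mul_of_nonneg_left (by linarith) ht0
    rw [Set.mem_ofPred_eq, ← hS]
    linarith

end Tail

/-! ### Union bound, bracketing and passage to the pull-back discrepancy. -/

section Driver

variable {X : Type*} [MeasurableSpace X] {s : ℕ} {K : Kernel X X} [IsMarkovKernel K]
  {π ν : Measure X} [IsProbabilityMeasure π] [IsProbabilityMeasure ν]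
  {φ : X → Cube s → X} {ψ : Cube s → X}

/-- A driver sequence with small deviations on a finite family of sets. -/
lemma exists_driver (hrev : K.IsReversible π) (hν : HasL2Density ν π) {l : ℝ}
    (hl : l = max 0 (specSup K π hrev.invariant)) (hl1 : l < 1) (hφ : IsUpdateFunction φ K)
    (hψ : IsGeneratorFunction ψ ν) {Γ : Finset (Set X)} (hΓ : ∀ C ∈ Γ, MeasurableSet C)
    (hempty : ∅ ∈ Γ) (n₀ : ℕ) {n : ℕ} (hn : 1 ≤ n) :
    ∃ u : Fin (n₀ + n) → Cube s, ∀ C ∈ Γ,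
      |(1 / (n : ℝ)) * ∑ j, C.indicator (fun _ => (1 : ℝ)) (burnInPoints φ ψ n₀ n u j) -
          π.real C| ≤
        √((1 + l) / (1 - l)) * (√(2 * Real.log ((Γ.card : ℝ) ^ 2 *
          densityNorm (iterMeasure K ν n₀) π)) / √(n : ℝ)) := by
  classical
  have hl0 : 0 ≤ l := hl ▸ le_max_left _ _
  have hn0 : (0 : ℝ) < n := by exact_mod_cast hn
  have h1l : 0 < 1 - l := by linarith
  set R := (1 + l) / (1 - l)
  have hR : 0 < R := by positivity
  set M := densityNorm (iterMeasure K ν n₀) π with hM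
  have hM1 : 1 ≤ M := by
    have hf := hν.isL2DensityOf.iterMeasure hrev n₀
    rw [hM, hf.densityNorm_eq]
    exact hf.one_le_norm
  have hm1 : 1 ≤ Γ.card := Finset.card_pos.2 ⟨_, hempty⟩
  set m : ℝ := (Γ.card : ℝ) with hm
  have hm1' : 1 ≤ m := by rw [hm]; exact_mod_cast hm1
  have hB1 : 1 ≤ m ^ 2 * M := one_le_mul_of_one_le_of_one_le (one_le_pow₀ hm1') hM1
  -- The threshold makes `n ε² / R = 2 log(m² M)`, so each tail is at most `2 M (m² M)⁻²`.
  set ε := √R * (√(2 * Real.log (m ^ 2 * M)) / √(n : ℝ)) with hε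
  have hε0 : 0 ≤ ε := by positivity
  have hexp : Real.exp (-(n * ε ^ 2 / R)) = ((m ^ 2 * M) ^ 2)⁻¹ := by
    have hlog : 0 ≤ 2 * Real.log (m ^ 2 * M) := mul_nonneg zero_le_two (Real.log_nonneg hB1)
    have h1 : n * ε ^ 2 / R = 2 * Real.log (m ^ 2 * M) := by
      rw [hε, mul_pow, div_pow, Real.sq_sqrt hR.le, Real.sq_sqrt hlog, Real.sq_sqrt hn0.le]
      field_simp
    rw [h1, Real.exp_neg, two_mul, Real.exp_add, Real.exp_log (by linarith), sq (m ^ 2 * M)]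
  set bad : Set X → Set (Fin (n₀ + n) → Cube s) := fun C => {u | ε <
    |(1 / (n : ℝ)) * ∑ j, C.indicator (fun _ => (1 : ℝ)) (burnInPoints φ ψ n₀ n u j) -
          π.real C|} with hbad
  -- The empty set never deviates. Dropping it leaves `m - 1` events, and the total `2 (m - 1) / (m⁴
  -- M)` is below `1` even when `m = M = 1`.
  have hvol : volume (⋃ C ∈ Γ.erase ∅, bad C) < 1 := by
    refine (measure_biUnion_finset_le _ _).trans_lt ?_
    calc ∑ C ∈ Γ.erase ∅, volume (bad C)
        ≤ ∑ C ∈ Γ.erase ∅, ENNReal.ofReal (2 * (M * ((m ^ 2 * M) ^ 2)⁻¹)) := by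
          refine Finset.sum_le_sum fun C hC => ?_
          refine (volume_deviation_le hrev hν hl hl1 hφ hψ (hΓ C (Finset.mem_of_mem_erase hC))
            hε0 n₀ hn).trans_eq ?_
          rw [hexp, ← hM, ENNReal.ofReal_mul zero_le_two, ENNReal.ofReal_ofNat]
      _ = ENNReal.ofReal ((m - 1) * (2 * (M * ((m ^ 2 * M) ^ 2)⁻¹))) := by
          rw [Finset.sum_const, Finset.card_erase_of_mem hempty, nsmul_eq_mul,
            ← ENNReal.ofReal_natCast, ← ENNReal.ofReal_mul (Nat.cast_nonneg _),
            Nat.cast_sub hm1, Nat.cast_one]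
      _ < 1 := by
          rw [ENNReal.ofReal_lt_one]
          have h2 : (m - 1) * (2 * (M * ((m ^ 2 * M) ^ 2)⁻¹)) = 2 * (m - 1) / (m ^ 4 * M) := by
            field_simp
          rw [h2, div_lt_one (by positivity)]
          have h3 : m ^ 2 ≤ m ^ 4 * M := by
            calc m ^ 2 = m ^ 2 * 1 := (mul_one _).symm
              _ ≤ m ^ 2 * (m ^ 2 * M) := by gcongr
              _ = _ := by ring
          nlinarith [sq_nonneg (m - 1)]
  have hne : (⋃ C ∈ Γ.erase ∅, bad C) ≠ Set.univ := by
    intro h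
    rw [h, measure_univ] at hvol
    exact lt_irrefl _ hvol
  obtain ⟨u, hu⟩ := (Set.ne_univ_iff_exists_notMem _).1 hne
  refine ⟨u, fun C hC => ?_⟩
  by_cases hC0 : C = ∅
  · subst hC0
    simpa using hε0
  · by_contra hcon
    refine hu (Set.mem_biUnion (Finset.mem_coe.2 (Finset.mem_erase.2 ⟨hC0, hC⟩)) ?_)
    exact not_le.1 hcon

/-- Empirical and true measure are both monotone, so the deviation on `A` lies between those on `C`
and `D` up to the gap `π(D) - π(C) ≤ δ`. -/
lemma IsDeltaCover.abs_sub_le {𝒜 : Set (Set X)} {δ ε : ℝ} {Γ : Finset (Set X)}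
    (hΓ : IsDeltaCover π 𝒜 δ Γ) {n : ℕ} {z : Fin n → X}
    (hz : ∀ C ∈ Γ, |(1 / (n : ℝ)) * ∑ j, C.indicator (fun _ => (1 : ℝ)) (z j) - π.real C| ≤ ε)
    {A : Set X} (hA : A ∈ 𝒜) :
    |(1 / (n : ℝ)) * ∑ j, A.indicator (fun _ => (1 : ℝ)) (z j) - π.real A| ≤ ε + δ := by
  obtain ⟨C, hC, D, hD, hCA, hAD, hδ⟩ := hΓ.bracket A hA
  have hmono : ∀ {B B' : Set X}, B ⊆ B' →
      (1 / (n : ℝ)) * ∑ j, B.indicator (fun _ => (1 : ℝ)) (z j) ≤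
        (1 / (n : ℝ)) * ∑ j, B'.indicator (fun _ => (1 : ℝ)) (z j) := fun h =>
    mul_le_mul_of_nonneg_left (Finset.sum_le_sum fun j _ =>
      Set.indicator_le_indicator_of_subset h (fun _ => zero_le_one) _) (by positivity)
  have h1 := hmono hCA
  have h2 := hmono hAD
  have h3 := (abs_le.1 (hz C hC)).1
  have h4 := (abs_le.1 (hz D hD)).2
  have h5 : π.real C ≤ π.real A := measureReal_mono hCA
  have h6 : π.real A ≤ π.real D := measureReal_mono hAD
  rw [measureReal_sdiff (hCA.trans hAD) (hΓ.measurableSet C hC)] at hδ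
  exact abs_le.2 ⟨by linarith, by linarith⟩

/-- The pull-back sets have volumes `νP^i(A)`; recentering them at `π(A)` costs exactly the averaged
bias. -/
lemma abs_localDiscrepancyBurnIn_le (hrev : K.IsReversible π) (hν : HasL2Density ν π) {l : ℝ}
    (hl : l = max 0 (specSup K π hrev.invariant)) (hl1 : l < 1) (hφ : IsUpdateFunction φ K)
    (hψ : IsGeneratorFunction ψ ν) {A : Set X} (hA : MeasurableSet A) (n₀ : ℕ) {n : ℕ}
    (hn : 1 ≤ n) (u : Fin (n₀ + n) → Cube s) :
    |localDiscrepancyBurnIn φ ψ n₀ n A u| ≤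
      |(1 / (n : ℝ)) * ∑ j, A.indicator (fun _ => (1 : ℝ)) (burnInPoints φ ψ n₀ n u j) -
          π.real A| +
        (1 - l ^ n) * opNorm0 K π hrev.invariant ^ n₀ / ((n : ℝ) * (1 - l)) *
          densitySubOneNorm ν π := by
  have hn0 : (0 : ℝ) < n := by exact_mod_cast hn
  have h1l : 0 < 1 - l := by linarith
  set T := ∑ j ∈ Finset.range n, ((iterMeasure K ν (n₀ + j)).real A - π.real A) with hT
  have hbias := abs_sum_iterMeasure_sub_le hrev hν hl hA n₀ n
  have hgeom : ∑ j ∈ Finset.range n, l ^ j = (1 - l ^ n) / (1 - l) := by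
    rw [eq_div_iff h1l.ne', mul_comm, mul_neg_geom_sum]
  rw [hgeom, ← hT] at hbias
  have hloc : localDiscrepancyBurnIn φ ψ n₀ n A u =
      ((1 / (n : ℝ)) * ∑ j, A.indicator (fun _ => (1 : ℝ)) (burnInPoints φ ψ n₀ n u j) -
          π.real A) - (1 / (n : ℝ)) * T := by
    have h1 : ∀ j : Fin n, (pullBack φ ψ (n₀ + j.val) A).indicator (fun _ => (1 : ℝ))
        (initialSegment u (Fin.natAdd n₀ j)) =
        A.indicator (fun _ => (1 : ℝ)) (burnInPoints φ ψ n₀ n u j) := fun j => rfl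
    have h2 : ∀ j : Fin n, volume.real (pullBack φ ψ (n₀ + j.val) A) =
        (iterMeasure K ν (n₀ + j.val)).real A := fun j => by
      rw [Measure.real, volume_pullBack hφ hψ _ hA]; rfl
    rw [localDiscrepancyBurnIn, hT, Finset.sum_range]
    simp only [h1, h2, Finset.sum_sub_distrib, Finset.sum_const, Finset.card_univ,
      Fintype.card_fin, nsmul_eq_mul]
    field_simp
    ring
  rw [hloc]
  refine (abs_sub _ _).trans (add_le_add le_rfl ?_)
  rw [abs_mul, abs_of_pos (one_div_pos.2 hn0)]
  refine (mul_le_mul_of_nonneg_left hbias (one_div_pos.2 hn0).le).trans_eq ?_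
  field_simp

end Driver

/-! ### Simplification of the constants. -/

section Constants

lemma sqrt_mul_sqrt_two_mul_div_le {l b L n : ℝ} (hl0 : 0 ≤ l) (hlb : l ≤ b) (hb : b < 1)
    (hn : 0 < n) (hL : 0 ≤ L) :
    √((1 + l) / (1 - l)) * (√(2 * L) / √n) ≤ 4 * √L / √(n * (1 - b)) := by
  have h1 : 0 < 1 - l := by linarith
  have h2 : 0 < 1 - b := by linarith
  have e : 4 * √L / √(n * (1 - b)) = √(16 * L / (n * (1 - b))) := by
    rw [Real.sqrt_div (by positivity), show 16 * L = 4 ^ 2 * L by norm_num,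
      Real.sqrt_mul (show (0 : ℝ) ≤ 4 ^ 2 by norm_num) L, Real.sqrt_sq zero_le_four]
  rw [e, ← Real.sqrt_div (by positivity), ← Real.sqrt_mul (by positivity)]
  refine Real.sqrt_le_sqrt ?_
  -- This comparison already yields the constant `2` after taking roots; the stated `4` leaves
  -- slack.
  have h3 : (1 + l) / (1 - l) ≤ 2 / (1 - b) := by
    rw [div_le_div_iff₀ h1 h2]
    nlinarith
  calc (1 + l) / (1 - l) * (2 * L / n) ≤ 2 / (1 - b) * (2 * L / n) := by gcongr
    _ = 4 * L / (n * (1 - b)) := by field_simp; ring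
    _ ≤ _ := by gcongr; norm_num

lemma bias_le {l b c n : ℝ} {k N : ℕ} (hl0 : 0 ≤ l) (hlb : l ≤ b) (hb : b < 1) (hn : 0 < n)
    (hc : 0 ≤ c) :
    (1 - l ^ N) * b ^ k / (n * (1 - l)) * c ≤ 2 * b ^ k * c / (n * (1 - b)) := by
  have hb0 : 0 ≤ b := hl0.trans hlb
  have h2 : 0 < 1 - b := by linarith
  have h3 : 1 - l ^ N ≤ 2 := by linarith [pow_nonneg hl0 N]
  rw [div_mul_eq_mul_div]
  gcongr

end Constants

end MCQMC

end

/-! ### Assembly of the burn-in theorem. -/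

theorem mainTheorem6 {d s : ℕ} (G : Set (EuclideanSpace ℝ (Fin d)))
    (K : ProbabilityTheory.Kernel G G) [ProbabilityTheory.IsMarkovKernel K]
    (π ν : MeasureTheory.Measure G)
    [MeasureTheory.IsProbabilityMeasure π] [MeasureTheory.IsProbabilityMeasure ν]
    (hrev : K.IsReversible π)
    (hν : MCQMC.HasL2Density ν π)
    (hvb : MCQMC.VarianceBounding K π hrev.invariant)
    (𝒜 : Set (Set G)) (h𝒜 : ∀ A ∈ 𝒜, MeasurableSet A)
    (Γ : ℝ → Finset (Set G)) (hΓ : ∀ δ : ℝ, 0 < δ → MCQMC.IsDeltaCover π 𝒜 δ (Γ δ))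
    (φ : G → MCQMC.Cube s → G) (hφ : MCQMC.IsUpdateFunction φ K)
    (ψ : MCQMC.Cube s → G) (hψ : MCQMC.IsGeneratorFunction ψ ν)
    (n₀ n : ℕ) (hn : 1 ≤ n) (δ : ℝ) (hδ : 0 < δ)
    (Λ Λ₀ β : ℝ) (hΛ : Λ = MCQMC.specSup K π hrev.invariant) (hΛ₀ : Λ₀ = max 0 Λ)
    (hβ : β = MCQMC.opNorm0 K π hrev.invariant) :
    MCQMC.HasL2Density (MCQMC.iterMeasure K ν n₀) π ∧
    ∃ u : Fin (n₀ + n) → MCQMC.Cube s,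
      MCQMC.starDiscrepancy 𝒜 π (MCQMC.burnInPoints φ ψ n₀ n u) ≤
          √((1 + Λ₀) / (1 - Λ₀)) *
            (√(2 * Real.log (((Γ δ).card : ℝ) ^ 2 *
              MCQMC.densityNorm (MCQMC.iterMeasure K ν n₀) π)) / √(n : ℝ)) + δ ∧
      (MCQMC.HasAbsSpectralGap K π hrev.invariant →
        Λ₀ ≤ β ∧ |Λ| ≤ β ∧
        MCQMC.pullBackDiscrepancyBurnIn 𝒜 φ ψ n₀ n u ≤
          √((1 + Λ₀) / (1 - Λ₀)) *
            (√(2 * Real.log (((Γ δ).card : ℝ) ^ 2 *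
              (1 + β ^ n₀ * MCQMC.densitySubOneNorm ν π))) / √(n : ℝ)) +
          (1 - Λ₀ ^ n) * β ^ n₀ / ((n : ℝ) * (1 - Λ₀)) * MCQMC.densitySubOneNorm ν π + δ ∧
        MCQMC.pullBackDiscrepancyBurnIn 𝒜 φ ψ n₀ n u ≤
          4 * √(Real.log (((Γ δ).card : ℝ) ^ 2 *
              (1 + β ^ n₀ * MCQMC.densitySubOneNorm ν π))) / √((n : ℝ) * (1 - β)) +
          2 * β ^ n₀ * MCQMC.densitySubOneNorm ν π / ((n : ℝ) * (1 - β)) + δ) := by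
  have hl : Λ₀ = max 0 (MCQMC.specSup K π hrev.invariant) := by rw [hΛ₀, hΛ]
  have hl0 : 0 ≤ Λ₀ := hl ▸ le_max_left _ _
  have hl1 : Λ₀ < 1 := by rw [hl]; exact max_lt zero_lt_one hvb
  have hn0 : (0 : ℝ) < n := by exact_mod_cast hn
  have hf := hν.isL2DensityOf.iterMeasure hrev n₀
  refine ⟨hf.hasL2Density, ?_⟩
  have hcov := hΓ δ hδ
  obtain ⟨u, hu⟩ := MCQMC.exists_driver hrev hν hl hl1 hφ hψ hcov.measurableSet hcov.empty_mem
    n₀ hn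
  have hdev := fun A (hA : A ∈ 𝒜) => hcov.abs_sub_le hu hA
  -- A real supremum over an empty class is `0`, so the bound itself must also be nonnegative.
  refine ⟨u, Real.iSup_le (fun A => hdev A A.2) (by positivity), fun hgap => ?_⟩
  have habs : |Λ| ≤ β := by rw [hΛ, hβ]; exact MCQMC.abs_specSup_le hrev
  have hlb : Λ₀ ≤ β := by
    rw [hΛ₀]; exact max_le ((abs_nonneg _).trans habs) ((le_abs_self _).trans habs)
  have hβ0 : 0 ≤ β := hl0.trans hlb
  have hβ1 : β < 1 := hβ ▸ hgap
  have hc0 : 0 ≤ MCQMC.densitySubOneNorm ν π := ENNReal.toReal_nonneg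
  have hm1 : (1 : ℝ) ≤ (Γ δ).card := by
    exact_mod_cast Finset.card_pos.2 ⟨_, hcov.empty_mem⟩
  have hM1 : 1 ≤ MCQMC.densityNorm (MCQMC.iterMeasure K ν n₀) π := by
    rw [hf.densityNorm_eq]; exact hf.one_le_norm
  have hMle : MCQMC.densityNorm (MCQMC.iterMeasure K ν n₀) π ≤
      1 + β ^ n₀ * MCQMC.densitySubOneNorm ν π := by
    rw [hβ]; exact MCQMC.densityNorm_iterMeasure_le hrev hν n₀
  have h1l : 0 < 1 - Λ₀ := by linarith
  have h1ln : 0 ≤ 1 - Λ₀ ^ n := by linarith [pow_le_one₀ (n := n) hl0 hl1.le]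
  have hB0 : 0 ≤ Real.log (((Γ δ).card : ℝ) ^ 2 *
      (1 + β ^ n₀ * MCQMC.densitySubOneNorm ν π)) :=
    Real.log_nonneg (one_le_mul_of_one_le_of_one_le (one_le_pow₀ hm1) (hM1.trans hMle))
  have hpb : MCQMC.pullBackDiscrepancyBurnIn 𝒜 φ ψ n₀ n u ≤
      √((1 + Λ₀) / (1 - Λ₀)) * (√(2 * Real.log (((Γ δ).card : ℝ) ^ 2 *
        (1 + β ^ n₀ * MCQMC.densitySubOneNorm ν π))) / √(n : ℝ)) +
      (1 - Λ₀ ^ n) * β ^ n₀ / ((n : ℝ) * (1 - Λ₀)) * MCQMC.densitySubOneNorm ν π + δ := by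
    refine Real.iSup_le (fun A => ?_) (by positivity)
    have h1 := MCQMC.abs_localDiscrepancyBurnIn_le hrev hν hl hl1 hφ hψ (h𝒜 A A.2) n₀ hn u
    rw [← hβ] at h1
    have h2 := hdev A A.2
    have h3 : √((1 + Λ₀) / (1 - Λ₀)) * (√(2 * Real.log (((Γ δ).card : ℝ) ^ 2 *
          MCQMC.densityNorm (MCQMC.iterMeasure K ν n₀) π)) / √(n : ℝ)) ≤
        √((1 + Λ₀) / (1 - Λ₀)) * (√(2 * Real.log (((Γ δ).card : ℝ) ^ 2 *
          (1 + β ^ n₀ * MCQMC.densitySubOneNorm ν π))) / √(n : ℝ)) := by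
      gcongr
    linarith
  refine ⟨hlb, habs, hpb, hpb.trans ?_⟩
  have h1 := MCQMC.sqrt_mul_sqrt_two_mul_div_le hl0 hlb hβ1 hn0 hB0
  have h2 := MCQMC.bias_le (k := n₀) (N := n) hl0 hlb hβ1 hn0 hc0
  linarith
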